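/- Fix a real number $\alpha>1$ and for real $a$ let $f_a(x)=-|x|^{\alpha}+a$. Write $n_a=f_a^{n}(0)/f_a(0)$ for the rescaled post-critical orbit, so that $0_a=0$ and $1_a=1$. For pairwise distinct reals $p,q,x$ with $x$ between $p$ and $q$ let $p_{p,q}(x)=\ln\frac{x-p}{q-x}$ be the Poincaré coordinate of $x$ in the oriented interval $(p,q)$ (where $p>q$ is allowed), and set $\bar a=p_{0,1}(|2_a|)$. Consider the parameters $a$ for which the kneading sequence of $f_a$ (the itinerary of the critical value $f_a(0)$ with respect to the critical point $0$) is $RLRLRL\ldots$, i.e. $f_a^{k}(0)>0$ for all odd $k$ and $f_a^{k}(0)<0$ for all even $k\ge 2$. On this set of parameters $\bar a$ is a strictly increasing function of $a$, and its range is a half-line $(-\infty,\bar a_1)$ with $\bar a_1\in\mathbb{R}$ depending only on $\alpha$. For every integer $n\ge 0$ the ratios $$r^n_e=\frac{|(2n+4)_a-(2n+2)_a|}{|(2n+2)_a-(2n)_a|}\qquad\text{and}\qquad r^n_o=\frac{|(2n+5)_a-(2n+3)_a|}{|(2n+3)_a-(2n+1)_a|}$$ are strictly increasing functions of $\bar a\in(-\infty,\bar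 a_1)$. Moreover, if $\bar a<\bar a'$ are the values of the new parameter at two such parameters $a,a'$, then for every integer $n\ge 0$ $$p_{(n+2)_{a'},\,n_{a'}}\big((n+4)_{a'}\big)-p_{(n+2)_{a},\,n_{a}}\big((n+4)_{a}\big)>p_{1,-1}(2_{a'})-p_{1,-1}(2_a).$$ -/

import Mathlib

noncomputable section

namespace PowerLaw

/-- Poincaré coordinate of `x` in the oriented interval from `p` to `q` (also used when `q < p`). -/
def poincare (p q x : ℝ) : ℝ := Real.log ((x - p) / (q - x))

/-- The unimodal power-law map `f_a(x) = -|x|^α + a`. -/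
def f (α a x : ℝ) : ℝ := -|x| ^ α + a

/-- The rescaled post-critical orbit `n_a = f_a^n(0) / f_a(0)`, so that `0_a = 0`, `1_a = 1`
(for `a ≠ 0`). -/
def pt (α a : ℝ) (n : ℕ) : ℝ := (f α a)^[n] 0 / f α a 0

/-- The new parameter `ā = p_{0,1}(|2_a|)`. -/
def abar (α a : ℝ) : ℝ := poincare 0 1 |pt α a 2|

/-- Symbols of the itinerary: left of, at, and right of the critical point `0`. -/
inductive Side
  | L
  | C
  | R

/-- The position of `x` relative to the critical point `0`. -/
def side (x : ℝ) : Side := if x < 0 then Side.L else if x = 0 then Side.C else Side.R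

/-- The kneading sequence of `f_a`: the itinerary of the critical value `f_a(0)`. -/
def kneading (α a : ℝ) (n : ℕ) : Side := side ((f α a)^[n + 1] 0)

/-- The parameters `a` whose kneading sequence is `RLRLRL…`. -/
def RLRL (α : ℝ) : Set ℝ :=
  {a | ∀ n, kneading α a n = if Even n then Side.R else Side.L}

/-- Ratio of consecutive intervals in the even nested family. -/
def ratioEven (α : ℝ) (n : ℕ) (a : ℝ) : ℝ :=
  |pt α a (2 * n + 4) - pt α a (2 * n + 2)| / |pt α a (2 * n + 2) - pt α a (2 * n)|

/-- Ratio of consecutive intervals in the odd nested family. -/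
def ratioOdd (α : ℝ) (n : ℕ) (a : ℝ) : ℝ :=
  |pt α a (2 * n + 5) - pt α a (2 * n + 3)| / |pt α a (2 * n + 3) - pt α a (2 * n + 1)|

end PowerLaw

end

noncomputable section

namespace PowerLaw

/-! Put x = a·y and t = a^(α-1). The orbit becomes that of y ↦ 1 - t|y|^α, and as long as the signs
alternate it is encoded by e_j = |y_(2j)| and o_j = y_(2j+1), with o_j = 1 - t·e_j^α and e_(j+1) =
t·o_j^α - 1. The coordinate p_{1,-1}(2_a) equals log(t/(2-t)). If t moves with speed t(2-t)/2, this
coordinate has speed 1. The Poincaré coordinates in question are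
log((e_(j+1)-e_(j+2))/(e_(j+2)-e_j)) and the same expression in o, so the theorem reduces to showing
that all of their speeds exceed 1 (`LogVelocity.one_lt_vel`). The ratios then increase because each
is X/(1+X) with log X such a coordinate.

An affine map does not change such a speed, and u ↦ u^α changes it by `logDefect` times differences
of logarithmic velocities (`crossVel_rpow`). Two facts control the corrections. Defects lie in [0,
α-1] and are monotone, by hyperbolic inequalities in z where the ratio of the two points is e^(-2z).
And the second iterate is concave on [0, t-1] (`sq_iterate_tangent`), which makes the corrections
over two maps nonnegative (`CriticalOrbit.logDefect_sub_nonneg`) up to a loss caused by the motion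
of t.

With τ = (2-t)/2, the loss from an even j to j+2 is at most τ(ζ_(j+2) - ζ_j)/ζ_(j+1), where ζ_j is
`zeta` at e_j. These losses telescope into the invariant `LogVelocity.Bounds`, so their total stays
below τ. The invariant also carries the velocities of the lengths e_(j+1)-e_j, which give the signs
needed in the step (`LogVelocity.bounds_add_two`). Odd indices of e follow by going forward from
even ones. Odd indices of o are obtained by comparing backwards with the next e
(`LogVelocity.vel_odd_succ_ge`).

The induction starts because the speed at index 0 has a closed form exceeding 2 + (t-1)(2-t)/2
(`LogVelocity.vel_zero_gt`). The admissible t form an interval (1, t₁), since positivity of e_2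
already forces the whole kneading sequence and reads g(t) < 1 for a convex g with g(1) = 1. -/

/-! ### The defect of the power map: bounds and monotonicity -/

/-- Difference of logarithmic derivatives, with respect to `a`, of `a ^ α - c ^ α` and of `a - c`,
multiplied by `a`. -/
def logDefect (α a c : ℝ) : ℝ := α * a ^ α / (a ^ α - c ^ α) - a / (a - c)

/-- Convexity of u^α: the tangent line at a, from Bernoulli's inequality at c/a. The factor a lets
the case a = 0 be included. -/
lemma mul_rpow_sub_le {α a c : ℝ} (hα : 1 ≤ α) (ha : 0 ≤ a) (hc : 0 ≤ c) :
    a * (a ^ α - c ^ α) ≤ α * a ^ α * (a - c) := by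
  rcases ha.eq_or_lt with rfl | ha
  · simp [Real.zero_rpow (by linarith : α ≠ 0)]
  have h := one_add_mul_self_le_rpow_one_add (s := c / a - 1)
    (by have : 0 ≤ c / a := by positivity
        linarith) hα
  have e1 : 1 + (c / a - 1) = c / a := by ring
  rw [e1, Real.div_rpow hc ha.le, le_div_iff₀ (by positivity)] at h
  have h2 := mul_le_mul_of_nonneg_left h ha.le
  have e2 : a * ((1 + α * (c / a - 1)) * a ^ α) = a * a ^ α + α * a ^ α * (c - a) := by
    field_simp
  rw [e2] at h2
  linarith

lemma rpow_ne_of_ne {α a c : ℝ} (hα : 1 < α) (ha : 0 ≤ a) (hc : 0 ≤ c) (h : a ≠ c) :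
    a ^ α ≠ c ^ α := by
  rcases h.lt_or_gt with h | h
  · exact (Real.rpow_lt_rpow ha h (by linarith)).ne
  · exact (Real.rpow_lt_rpow hc h (by linarith)).ne'

lemma logDefect_add_swap {α a c : ℝ} (hα : 1 < α) (ha : 0 ≤ a) (hc : 0 ≤ c) (h : a ≠ c) :
    logDefect α a c + logDefect α c a = α - 1 := by
  have h1 := sub_ne_zero.2 (rpow_ne_of_ne hα ha hc h)
  have h2 := sub_ne_zero.2 h
  unfold logDefect
  rw [← neg_sub (a ^ α) (c ^ α), ← neg_sub a c]
  simp only [div_neg]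
  field_simp
  ring

lemma logDefect_nonneg {α a c : ℝ} (hα : 1 < α) (ha : 0 ≤ a) (hc : 0 ≤ c) (h : a ≠ c) :
    0 ≤ logDefect α a c := by
  have h0 := mul_rpow_sub_le hα.le ha hc
  unfold logDefect
  rw [sub_nonneg]
  rcases h.lt_or_gt with h | h
  · have h1 := Real.rpow_lt_rpow ha h (by linarith : 0 < α)
    rw [← neg_sub (c ^ α) (a ^ α), ← neg_sub c a]
    simp only [div_neg, neg_le_neg_iff]
    rw [div_le_div_iff₀ (by linarith) (by linarith)]
    linarith
  · have h1 := Real.rpow_lt_rpow hc h (by linarith : 0 < α)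
    rw [div_le_div_iff₀ (by linarith) (by linarith)]
    linarith

lemma logDefect_le {α a c : ℝ} (hα : 1 < α) (ha : 0 ≤ a) (hc : 0 ≤ c) (h : a ≠ c) :
    logDefect α a c ≤ α - 1 := by
  have h1 := logDefect_add_swap hα ha hc h
  have h2 := logDefect_nonneg hα hc ha h.symm
  linarith

lemma mul_sinh_le_sinh_mul {α z : ℝ} (hα : 1 ≤ α) (hz : 0 ≤ z) :
    α * Real.sinh z ≤ Real.sinh (α * z) := by
  have hm : MonotoneOn (fun z => Real.sinh (α * z) - α * Real.sinh z) (Set.Ici 0) := by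
    have hd : ∀ z, HasDerivAt (fun z => Real.sinh (α * z) - α * Real.sinh z)
        (Real.cosh (α * z) * (α * 1) - α * Real.cosh z) z := fun z =>
      (((hasDerivAt_id z).const_mul α).sinh).sub ((Real.hasDerivAt_sinh z).const_mul α)
    refine monotoneOn_of_deriv_nonneg (convex_Ici 0)
      (fun z _ => (hd z).continuousAt.continuousWithinAt)
      (fun z _ => (hd z).differentiableAt.differentiableWithinAt) ?_
    intro z hz
    rw [interior_Ici] at hz
    have hz : 0 < z := hz
    rw [(hd z).deriv]
    have : Real.cosh z ≤ Real.cosh (α * z) := by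
      rw [Real.cosh_le_cosh, abs_of_pos hz, abs_of_pos (by positivity)]
      nlinarith
    nlinarith
  have := hm (Set.mem_Ici.2 le_rfl) (Set.mem_Ici.2 hz) hz
  simp at this
  linarith

lemma cosh_mul_sinh_mul_le {α z : ℝ} (hα : 1 ≤ α) (hz : 0 ≤ z) :
    Real.cosh z * Real.sinh (α * z) ≤ α * (Real.sinh z * Real.cosh (α * z)) := by
  have hm : MonotoneOn (fun z => α * (Real.sinh z * Real.cosh (α * z))
      - Real.cosh z * Real.sinh (α * z)) (Set.Ici 0) := by
    have hd : ∀ z, HasDerivAt (fun z => α * (Real.sinh z * Real.cosh (α * z))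
        - Real.cosh z * Real.sinh (α * z))
        (α * (Real.cosh z * Real.cosh (α * z) + Real.sinh z * (Real.sinh (α * z) * (α * 1)))
          - (Real.sinh z * Real.sinh (α * z) + Real.cosh z * (Real.cosh (α * z) * (α * 1)))) z :=
      fun z =>
      (((Real.hasDerivAt_sinh z).mul (((hasDerivAt_id z).const_mul α).cosh)).const_mul α).sub
        ((Real.hasDerivAt_cosh z).mul (((hasDerivAt_id z).const_mul α).sinh))
    refine monotoneOn_of_deriv_nonneg (convex_Ici 0)
      (fun z _ => (hd z).continuousAt.continuousWithinAt)
      (fun z _ => (hd z).differentiableAt.differentiableWithinAt) ?_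
    intro z hz
    rw [interior_Ici] at hz
    have hz : 0 < z := hz
    rw [(hd z).deriv]
    have h1 : 0 ≤ Real.sinh z * Real.sinh (α * z) :=
      mul_nonneg (Real.sinh_nonneg_iff.2 hz.le) (Real.sinh_nonneg_iff.2 (by positivity))
    have h2 : 0 ≤ (α ^ 2 - 1) * (Real.sinh z * Real.sinh (α * z)) :=
      mul_nonneg (by nlinarith) h1
    linarith
  have := hm (Set.mem_Ici.2 le_rfl) (Set.mem_Ici.2 hz) hz
  simp at this
  linarith

/-- The substitution ρ = e^(-2z) makes 1 - ρ and 1 + ρ proportional to sinh z and cosh z, and 1 -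
ρ^α and 1 + ρ^α to sinh(αz) and cosh(αz). -/
lemma exists_exp_neg_two_mul {ρ : ℝ} (h0 : 0 < ρ) (h1 : ρ < 1) (α : ℝ) :
    ∃ z, 0 < z ∧ ρ * Real.exp z = Real.exp (-z) ∧
      ρ ^ α * Real.exp (α * z) = Real.exp (-(α * z)) := by
  refine ⟨-Real.log ρ / 2, ?_, ?_, ?_⟩
  · have := Real.log_neg h0 h1
    linarith
  · nth_rewrite 1 [← Real.exp_log h0]
    rw [← Real.exp_add]
    congr 1; ring
  · rw [Real.rpow_def_of_pos h0, ← Real.exp_add]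
    congr 1; ring

/-- This is α sinh z ≤ sinh(αz), squared, with ρ = e^(-2z). It is the sign of the derivative in
`antitoneOn_logDefect_ratio`. -/
lemma sq_mul_rpow_mul_one_sub_sq_le {α ρ : ℝ} (hα : 1 ≤ α) (h0 : 0 < ρ) (h1 : ρ < 1) :
    α ^ 2 * ρ ^ (α - 1) * (1 - ρ) ^ 2 ≤ (1 - ρ ^ α) ^ 2 := by
  obtain ⟨z, hz, e1, e2⟩ := exists_exp_neg_two_mul h0 h1 α
  have hs := mul_sinh_le_sinh_mul hα hz.le
  have hs0 : 0 ≤ α * Real.sinh z := mul_nonneg (by linarith) (Real.sinh_nonneg_iff.2 hz.le)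
  have hsq := pow_le_pow_left₀ hs0 hs 2
  rw [Real.sinh_eq, Real.sinh_eq, ← e1, ← e2] at hsq
  have e3 : ρ ^ (α - 1) * (Real.exp (α * z)) ^ 2 = Real.exp z ^ 2 := by
    rw [Real.rpow_sub_one h0.ne']
    have hx : ρ * Real.exp z * Real.exp z = 1 := by rw [e1, ← Real.exp_add]; simp
    have hy : ρ ^ α * Real.exp (α * z) * Real.exp (α * z) = 1 := by
      rw [e2, ← Real.exp_add]; simp
    field_simp
    nlinarith
  have hpos : 0 < Real.exp (α * z) ^ 2 := by positivity
  refine le_of_mul_le_mul_right ?_ hpos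
  calc α ^ 2 * ρ ^ (α - 1) * (1 - ρ) ^ 2 * Real.exp (α * z) ^ 2
      = α ^ 2 * (1 - ρ) ^ 2 * (ρ ^ (α - 1) * Real.exp (α * z) ^ 2) := by ring
    _ = 4 * (α * ((Real.exp z - ρ * Real.exp z) / 2)) ^ 2 := by rw [e3]; ring
    _ ≤ 4 * ((Real.exp (α * z) - ρ ^ α * Real.exp (α * z)) / 2) ^ 2 := by linarith
    _ = _ := by ring

lemma logDefect_eq_ratio {α a c : ℝ} (ha : 0 < a) (hc : 0 ≤ c) :
    logDefect α a c = α / (1 - (c / a) ^ α) - 1 / (1 - c / a) := by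
  unfold logDefect
  rw [Real.div_rpow hc ha.le]
  have h : 0 < a ^ α := by positivity
  congr 1
  · rw [one_sub_div h.ne', div_div_eq_mul_div]
  · rw [one_sub_div ha.ne', div_div_eq_mul_div, one_mul]

lemma antitoneOn_logDefect_ratio {α : ℝ} (hα : 1 < α) :
    AntitoneOn (fun ρ : ℝ => α / (1 - ρ ^ α) - 1 / (1 - ρ)) (Set.Ico 0 1) := by
  have hlt : ∀ ρ ∈ Set.Ico (0 : ℝ) 1, 0 < 1 - ρ ^ α := fun ρ h => by
    have := Real.rpow_lt_one h.1 h.2 (by linarith : 0 < α)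
    linarith
  have hd : ∀ ρ ∈ Set.Ico (0 : ℝ) 1, HasDerivAt (fun ρ : ℝ => α / (1 - ρ ^ α) - 1 / (1 - ρ))
      ((0 * (1 - ρ ^ α) - α * (-(α * ρ ^ (α - 1)))) / (1 - ρ ^ α) ^ 2
        - (0 * (1 - ρ) - 1 * (-1)) / (1 - ρ) ^ 2) ρ := fun ρ h =>
    ((hasDerivAt_const ρ α).div ((Real.hasDerivAt_rpow_const (Or.inr hα.le)).const_sub 1)
      (hlt ρ h).ne').sub ((hasDerivAt_const ρ (1 : ℝ)).div ((hasDerivAt_id ρ).const_sub 1)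
        (sub_ne_zero.2 h.2.ne'))
  refine antitoneOn_of_deriv_nonpos (convex_Ico 0 1)
    (fun z hz => (hd z hz).continuousAt.continuousWithinAt)
    (fun z hz => (hd z (interior_subset hz)).differentiableAt.differentiableWithinAt) ?_
  intro ρ hρ
  rw [(hd ρ (interior_subset hρ)).deriv]
  rw [interior_Ico] at hρ
  have h1 := sq_mul_rpow_mul_one_sub_sq_le hα.le hρ.1 hρ.2
  have h2 := hlt ρ ⟨hρ.1.le, hρ.2⟩
  have h3 : 0 < 1 - ρ := sub_pos.2 hρ.2
  rw [sub_nonpos, div_le_div_iff₀ (by positivity) (by positivity)]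
  linarith

lemma logDefect_anti_right {α a c c' : ℝ} (hα : 1 < α) (hc : 0 ≤ c) (h : c ≤ c') (h' : c' < a) :
    logDefect α a c' ≤ logDefect α a c := by
  have ha : 0 < a := by linarith
  rw [logDefect_eq_ratio ha hc, logDefect_eq_ratio ha (hc.trans h)]
  refine antitoneOn_logDefect_ratio hα ⟨by positivity, ?_⟩ ⟨div_nonneg (by linarith) ha.le, ?_⟩ ?_
  · rw [div_lt_one ha]; linarith
  · rwa [div_lt_one ha]
  · gcongr

/-- The ratio c/a exceeds 1 here, so `logDefect_add_swap` exchanges the arguments and reduces to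
ratios in [0, 1). -/
lemma logDefect_anti_right_above {α a c c' : ℝ} (hα : 1 < α) (ha : 0 < a) (h : a < c)
    (h' : c ≤ c') : logDefect α a c' ≤ logDefect α a c := by
  have e1 := logDefect_add_swap hα ha.le (by linarith : 0 ≤ c) h.ne
  have e2 := logDefect_add_swap hα ha.le (by linarith : 0 ≤ c') (by linarith : a < c').ne
  suffices logDefect α c a ≤ logDefect α c' a by linarith
  have hc : 0 < c := by linarith
  have hc' : 0 < c' := by linarith
  rw [logDefect_eq_ratio hc ha.le, logDefect_eq_ratio hc' ha.le]
  refine antitoneOn_logDefect_ratio hα ⟨by positivity, ?_⟩ ⟨by positivity, ?_⟩ ?_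
  · rw [div_lt_one hc']; linarith
  · rwa [div_lt_one hc]
  · gcongr

/-- The two defects of a pair add up to α - 1, and the larger point has the larger share. In z this
is tanh(αz) ≤ α tanh z. -/
lemma half_le_logDefect {α a c : ℝ} (hα : 1 < α) (hc : 0 ≤ c) (h : c < a) :
    (α - 1) / 2 ≤ logDefect α a c := by
  have ha : 0 < a := by linarith
  rcases hc.eq_or_lt with rfl | hc
  · have := logDefect_add_swap hα ha.le le_rfl ha.ne'
    have h0 : logDefect α 0 a = 0 := by
      simp [logDefect, Real.zero_rpow (by linarith : α ≠ 0)]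
    linarith
  rw [logDefect_eq_ratio ha hc.le]
  set ρ := c / a with hρ
  have h0 : 0 < ρ := by positivity
  have h1 : ρ < 1 := by rwa [hρ, div_lt_one ha]
  have h1α := Real.rpow_lt_one h0.le h1 (by linarith : 0 < α)
  obtain ⟨z, hz, e1, e2⟩ := exists_exp_neg_two_mul h0 h1 α
  have hs := cosh_mul_sinh_mul_le hα.le hz.le
  rw [Real.sinh_eq, Real.sinh_eq, Real.cosh_eq, Real.cosh_eq, ← e1, ← e2] at hs
  have hs2 : (1 + ρ) * (1 - ρ ^ α) ≤ α * ((1 - ρ) * (1 + ρ ^ α)) := by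
    have hpos : 0 < Real.exp z * Real.exp (α * z) := by positivity
    refine le_of_mul_le_mul_right ?_ hpos
    linarith
  have h2 : 0 < 1 - ρ := by linarith
  have h3 : 0 < 1 - ρ ^ α := by linarith
  rw [div_sub_div _ _ h3.ne' h2.ne', div_le_div_iff₀ (by norm_num) (by positivity)]
  nlinarith

lemma logDefect_swap_le {α a b c : ℝ} (hα : 1 < α) (ha : 0 ≤ a) (h : a < c) (h' : c < b) :
    logDefect α a c ≤ logDefect α b c := by
  have h1 := logDefect_add_swap hα ha (by linarith : 0 ≤ c) h.ne
  have h2 := half_le_logDefect hα ha h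
  have h3 := half_le_logDefect hα (by linarith) h'
  linarith

/-! ### Concavity of the second iterate -/

/-- Tangent-line inequality for the (concave) second iterate `u ↦ t * (1 - t * u ^ α) ^ α - 1`
on `[0, b]`. -/
lemma sq_iterate_tangent {α t b u v : ℝ} (hα : 1 < α) (ht : 0 < t)
    (hb : (α + 1) * (t * b ^ α) ≤ 1) (hu : 0 ≤ u) (hub : u ≤ b) (hv : 0 ≤ v) (hvb : v ≤ b) :
    α ^ 2 * (t * u ^ α / (1 - t * u ^ α)) * (t * (1 - t * u ^ α) ^ α) * (v - u) ≤
      u * (t * (1 - t * u ^ α) ^ α - t * (1 - t * v ^ α) ^ α) := by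
  have hα0 : 0 < α := by linarith
  rcases hu.eq_or_lt with rfl | hu
  · simp [Real.zero_rpow hα0.ne']
  have hbd : ∀ s, 0 ≤ s → s ≤ b → (α + 1) * (t * s ^ α) ≤ 1 := fun s h1 h2 => by
    refine le_trans ?_ hb
    gcongr
  have hpos : ∀ s, 0 ≤ s → s ≤ b → 0 < 1 - t * s ^ α := fun s h1 h2 => by
    have h3 := hbd s h1 h2
    have h4 : 0 ≤ t * s ^ α := by positivity
    nlinarith
  -- The derivative of the iterate is -α²t²(s(1 - t·s^α))^(α-1). The base s(1 - t·s^α) increases as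
  -- long as (α+1)·t·s^α ≤ 1, which is where the hypothesis on b comes from.
  have hmono : ∀ s s', 0 < s → s ≤ s' → s' ≤ b →
      (s * (1 - t * s ^ α)) ^ (α - 1) ≤ (s' * (1 - t * s' ^ α)) ^ (α - 1) := by
    intro s s' h0 h1 h2
    have hs' : 0 < s' := by linarith
    refine Real.rpow_le_rpow (mul_nonneg h0.le (hpos s h0.le (h1.trans h2)).le) ?_ (by linarith)
    have h3 := mul_rpow_sub_le (by linarith : 1 ≤ α) hs'.le h0.le
    have h5 := hbd s' hs'.le h2
    have h6 : (α + 1) * (t * s' ^ α) * (s' - s) ≤ 1 * (s' - s) :=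
      mul_le_mul_of_nonneg_right h5 (by linarith)
    have h7 : t * (s' * s' ^ α) - t * (s' * s ^ α) ≤ t * (α * s' ^ α * (s' - s)) := by
      rw [← mul_sub, ← mul_sub]
      exact mul_le_mul_of_nonneg_left h3 ht.le
    have h8 : s ^ α ≤ s' ^ α := by gcongr
    have h9 : 0 ≤ t * ((s' - s) * (s' ^ α - s ^ α)) :=
      mul_nonneg ht.le (mul_nonneg (by linarith) (by linarith))
    have h10 : t * s' ^ α * (s' - s) + t * (α * s' ^ α * (s' - s)) ≤ s' - s := by linarith
    nlinarith
  have hd : ∀ s, 0 ≤ s → s ≤ b → HasDerivAt (fun s => t * (1 - t * s ^ α) ^ α)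
      (t * (-(t * (α * s ^ (α - 1))) * α * (1 - t * s ^ α) ^ (α - 1))) s := fun s h1 h2 =>
    (((Real.hasDerivAt_rpow_const (Or.inr hα.le)).const_mul t).const_sub 1).rpow_const
      (Or.inl (hpos s h1 h2).ne') |>.const_mul t
  have hd' : ∀ s, 0 ≤ s → s ≤ b → HasDerivAt (fun s => t * (1 - t * s ^ α) ^ α)
      (-(α ^ 2 * t ^ 2 * (s * (1 - t * s ^ α)) ^ (α - 1))) s := fun s h1 h2 => by
    convert hd s h1 h2 using 1
    rw [Real.mul_rpow h1 (hpos s h1 h2).le]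
    ring
  have hzeta : α ^ 2 * (t * u ^ α / (1 - t * u ^ α)) * (t * (1 - t * u ^ α) ^ α) =
      u * (α ^ 2 * t ^ 2 * (u * (1 - t * u ^ α)) ^ (α - 1)) := by
    have h := hpos u hu.le hub
    rw [Real.mul_rpow hu.le h.le, Real.rpow_sub_one hu.ne', Real.rpow_sub_one h.ne']
    field_simp
  rw [hzeta]
  have ht2 : 0 < α ^ 2 * t ^ 2 := by positivity
  rcases lt_trichotomy u v with h | rfl | h
  · obtain ⟨ξ, hξ, he⟩ := exists_hasDerivAt_eq_slope (fun s => t * (1 - t * s ^ α) ^ α)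
      (fun s => -(α ^ 2 * t ^ 2 * (s * (1 - t * s ^ α)) ^ (α - 1))) h
      (fun s hs => (hd' s (by linarith [hs.1]) (by linarith [hs.2])).continuousAt.continuousWithinAt)
      (fun s hs => hd' s (by linarith [hs.1]) (by linarith [hs.2]))
    have h2 := hmono u ξ hu hξ.1.le (by linarith [hξ.2])
    rw [eq_div_iff (by linarith)] at he
    have h3 := mul_le_mul_of_nonneg_left h2 ht2.le
    have h4 : α ^ 2 * t ^ 2 * (u * (1 - t * u ^ α)) ^ (α - 1) * (v - u) ≤
      t * (1 - t * u ^ α) ^ α - t * (1 - t * v ^ α) ^ α := by nlinarith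
    nlinarith
  · simp
  · obtain ⟨ξ, hξ, he⟩ := exists_hasDerivAt_eq_slope (fun s => t * (1 - t * s ^ α) ^ α)
      (fun s => -(α ^ 2 * t ^ 2 * (s * (1 - t * s ^ α)) ^ (α - 1))) h
      (fun s hs => (hd' s (by linarith [hs.1]) (by linarith [hs.2])).continuousAt.continuousWithinAt)
      (fun s hs => hd' s (by linarith [hs.1]) (by linarith [hs.2]))
    have h2 := hmono ξ u (by linarith [hξ.1]) hξ.2.le hub
    rw [eq_div_iff (by linarith)] at he
    have h3 := mul_le_mul_of_nonneg_left h2 ht2.le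
    have h4 : α ^ 2 * t ^ 2 * (u * (1 - t * u ^ α)) ^ (α - 1) * (v - u) ≤
      t * (1 - t * u ^ α) ^ α - t * (1 - t * v ^ α) ^ α := by nlinarith
    nlinarith

/-- Otherwise 1 - d < 1/(1 + 1/α), and (1 + 1/α)^α ≥ 2 gives (1-d)^α ≤ 1/2, against t < 2. -/
lemma succ_mul_le_one {α t d : ℝ} (hα : 1 < α) (ht : t < 2) (hd : d < 1)
    (h : 1 < t * (1 - d) ^ α) : (α + 1) * d ≤ 1 := by
  by_contra! hc
  have hα0 : 0 < α := by linarith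
  have h1 : (1 - d) ≤ 1 / (1 + 1 / α) := by
    rw [le_div_iff₀ (by positivity)]
    field_simp
    linarith
  have h2 : (1 - d) ^ α ≤ (1 / (1 + 1 / α)) ^ α := by
    have : 0 ≤ 1 - d := by linarith
    gcongr
  have h3 := one_add_mul_self_le_rpow_one_add (s := 1 / α)
    (by have : 0 < 1 / α := by positivity
        linarith) hα.le
  rw [mul_one_div_cancel hα0.ne'] at h3
  rw [Real.div_rpow zero_le_one (by positivity), Real.one_rpow] at h2
  have h4 : 1 / (1 + 1 / α) ^ α ≤ 1 / 2 := by
    apply one_div_le_one_div_of_le <;> linarith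
  have h5 : 0 ≤ (1 - d) ^ α := Real.rpow_nonneg (by linarith) _
  nlinarith

/-! ### The critical orbit and its order structure -/

/-- Velocity of the Poincaré coordinate `log ((a₂ - a₀) / (a₁ - a₂))` (up to sign) when the point
`aᵢ` moves with logarithmic velocity `lᵢ`. -/
def crossVel (a₀ a₁ a₂ l₀ l₁ l₂ : ℝ) : ℝ := a₁ * (l₁ - l₂) / (a₁ - a₂) - a₀ * (l₂ - l₀) / (a₂ - a₀)

/-- Minus the logarithmic derivative of `1 - t * u ^ α` with respect to `log (t * u ^ α)`. -/
def zeta (α t u : ℝ) : ℝ := t * u ^ α / (1 - t * u ^ α)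

/-- The absolute values `e j = |y (2 j)|` and `o j = y (2 j + 1)` of a critical orbit
`y (n + 1) = 1 - t * |y n| ^ α` with kneading sequence `RLRL…`. -/
structure CriticalOrbit (α t : ℝ) (e o : ℕ → ℝ) : Prop where
  one_lt_exp : 1 < α
  one_lt : 1 < t
  e_zero : e 0 = 0
  o_eq : ∀ j, o j = 1 - t * e j ^ α
  e_succ : ∀ j, e (j + 1) = t * o j ^ α - 1
  o_pos : ∀ j, 0 < o j
  e_succ_pos : ∀ j, 0 < e (j + 1)

namespace CriticalOrbit

variable {α t : ℝ} {e o : ℕ → ℝ}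

lemma e_nonneg (H : CriticalOrbit α t e o) (j : ℕ) : 0 ≤ e j := by
  cases j with
  | zero => exact H.e_zero.ge
  | succ j => exact (H.e_succ_pos j).le

lemma o_zero (H : CriticalOrbit α t e o) : o 0 = 1 := by
  have := H.one_lt_exp
  rw [H.o_eq, H.e_zero, Real.zero_rpow (by linarith)]
  ring

lemma e_one (H : CriticalOrbit α t e o) : e 1 = t - 1 := by
  rw [H.e_succ, H.o_zero]
  simp

lemma o_lt (H : CriticalOrbit α t e o) {i k : ℕ} (h : e i < e k) : o k < o i := by
  rw [H.o_eq, H.o_eq]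
  have := Real.rpow_lt_rpow (H.e_nonneg i) h (by linarith [H.one_lt_exp] : 0 < α)
  have := H.one_lt
  nlinarith

lemma e_succ_lt (H : CriticalOrbit α t e o) {i k : ℕ} (h : e i < e k) :
    e (k + 1) < e (i + 1) := by
  rw [H.e_succ, H.e_succ]
  have := Real.rpow_lt_rpow (H.o_pos k).le (H.o_lt h) (by linarith [H.one_lt_exp] : 0 < α)
  have := H.one_lt
  nlinarith

lemma o_le_one (H : CriticalOrbit α t e o) (j : ℕ) : o j ≤ 1 := by
  rw [H.o_eq]
  have h1 := Real.rpow_nonneg (H.e_nonneg j) α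
  have := H.one_lt
  nlinarith

lemma e_le (H : CriticalOrbit α t e o) (j : ℕ) : e j ≤ t - 1 := by
  have h1 := H.one_lt
  cases j with
  | zero => rw [H.e_zero]; linarith
  | succ j =>
    rw [H.e_succ]
    have := Real.rpow_le_one (H.o_pos j).le (H.o_le_one j) (by linarith [H.one_lt_exp] : 0 ≤ α)
    nlinarith

lemma lt_two (H : CriticalOrbit α t e o) : t < 2 := by
  by_contra! h
  have h1 := H.o_pos 1
  rw [H.o_eq, H.e_one] at h1
  have h2 := Real.one_le_rpow (by linarith : 1 ≤ t - 1) (by linarith [H.one_lt_exp] : 0 ≤ α)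
  nlinarith

/-- The second iterate e_j ↦ e_(j+1) reverses order, so two applications carry the initial pattern
e_0 < e_2 < e_1 to all even indices. -/
lemma lt_of_even (H : CriticalOrbit α t e o) {j : ℕ} (hj : Even j) :
    e j < e (j + 2) ∧ e (j + 2) < e (j + 1) := by
  obtain ⟨m, rfl⟩ := hj
  induction m with
  | zero =>
    have h0 : e 0 < e 2 := by rw [H.e_zero]; exact H.e_succ_pos 1
    have h1 : e 0 < e 1 := by rw [H.e_zero]; exact H.e_succ_pos 0
    exact ⟨h0, H.e_succ_lt h1⟩
  | succ m ih =>
    have h1 := H.e_succ_lt (H.e_succ_lt ih.1)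
    have h2 := H.e_succ_lt (H.e_succ_lt ih.2)
    rw [show m + 1 + (m + 1) = m + m + 2 by ring]
    exact ⟨h1, h2⟩

lemma lt_of_even' (H : CriticalOrbit α t e o) {j : ℕ} (hj : Even j) :
    e (j + 2) < e (j + 3) ∧ e (j + 3) < e (j + 1) :=
  ⟨H.e_succ_lt (H.lt_of_even hj).2, H.e_succ_lt (H.lt_of_even hj).1⟩

lemma succ_mul_le (H : CriticalOrbit α t e o) : (α + 1) * (t * (t - 1) ^ α) ≤ 1 := by
  have h2 := H.e_succ_pos 1
  have h1 := H.o_pos 1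
  rw [H.e_succ, H.o_eq, H.e_one] at h2
  rw [H.o_eq, H.e_one] at h1
  exact succ_mul_le_one H.one_lt_exp H.lt_two (by linarith) (by linarith)

lemma zeta_eq (H : CriticalOrbit α t e o) (j : ℕ) : zeta α t (e j) = t * e j ^ α / o j := by
  rw [zeta, H.o_eq]

lemma zeta_nonneg (H : CriticalOrbit α t e o) (j : ℕ) : 0 ≤ zeta α t (e j) := by
  rw [H.zeta_eq]
  have := H.one_lt
  exact div_nonneg (mul_nonneg (by linarith) (Real.rpow_nonneg (H.e_nonneg j) α)) (H.o_pos j).le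

lemma zeta_pos (H : CriticalOrbit α t e o) (j : ℕ) : 0 < zeta α t (e (j + 1)) := by
  rw [H.zeta_eq]
  have := H.one_lt
  exact div_pos (mul_pos (by linarith) (Real.rpow_pos_of_pos (H.e_succ_pos j) α)) (H.o_pos _)

lemma zeta_lt (H : CriticalOrbit α t e o) {i k : ℕ} (h : e i < e k) :
    zeta α t (e i) < zeta α t (e k) := by
  have e1 : ∀ j, zeta α t (e j) = 1 / o j - 1 := fun j => by
    rw [H.zeta_eq, div_sub_one (H.o_pos j).ne']
    congr 1
    rw [H.o_eq]; ring
  rw [e1, e1]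
  have := one_div_lt_one_div_of_lt (H.o_pos k) (H.o_lt h)
  linarith

lemma tangent (H : CriticalOrbit α t e o) (i k : ℕ) :
    α ^ 2 * zeta α t (e i) * (1 + e (i + 1)) * (e k - e i) ≤ e i * (e (i + 1) - e (k + 1)) := by
  have h := sq_iterate_tangent H.one_lt_exp (by linarith [H.one_lt]) H.succ_mul_le (H.e_nonneg i)
    (H.e_le i) (H.e_nonneg k) (H.e_le k)
  rw [← H.o_eq i, ← H.o_eq k] at h
  rw [H.zeta_eq, H.e_succ, H.e_succ]
  convert h using 1 <;> ring

/-- The concavity of the second iterate, in terms of `logDefect`. -/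
lemma logDefect_sub_nonneg (H : CriticalOrbit α t e o) {i k : ℕ} (h : e i ≠ e k) :
    0 ≤ logDefect α (e i) (e k) - α * zeta α t (e i) * logDefect α (o i) (o k) := by
  have hα := H.one_lt_exp
  have ht := H.one_lt
  have hT := H.tangent i k
  have hne := rpow_ne_of_ne hα (H.e_nonneg i) (H.e_nonneg k) h
  have ho : o i ≠ o k := by
    rw [H.o_eq, H.o_eq]
    intro h'
    apply hne
    have h'' : t * (e i ^ α - e k ^ α) = 0 := by linarith
    rcases mul_eq_zero.1 h'' with h3 | h3
    · linarith
    · linarith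
  have hone := rpow_ne_of_ne hα (H.o_pos i).le (H.o_pos k).le ho
  have hoi := H.o_pos i
  -- Since o_i - o_k = t(e_k^α - e_i^α), the power term of the first defect cancels the linear term
  -- of the second. What remains has the sign given by the tangent inequality.
  have key : logDefect α (e i) (e k) - α * zeta α t (e i) * logDefect α (o i) (o k) =
      e i / (e k - e i) - α ^ 2 * zeta α t (e i) * (1 + e (i + 1)) / (e (i + 1) - e (k + 1)) := by
    unfold logDefect
    have h1 : o i - o k = t * (e k ^ α - e i ^ α) := by rw [H.o_eq, H.o_eq]; ring
    have h2 : e (i + 1) - e (k + 1) = t * (o i ^ α - o k ^ α) := by rw [H.e_succ, H.e_succ]; ring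
    have h3 : 1 + e (i + 1) = t * o i ^ α := by rw [H.e_succ]; ring
    rw [h1, h2, h3, H.zeta_eq, ← neg_sub (e i ^ α) (e k ^ α), ← neg_sub (e i) (e k)]
    have n1 := sub_ne_zero.2 hone
    have n2 := sub_ne_zero.2 hne
    have n3 := sub_ne_zero.2 h
    field_simp
    ring
  rw [key, sub_nonneg]
  rcases h.lt_or_gt with h | h
  · have h' := H.e_succ_lt h
    rw [div_le_div_iff₀ (by linarith) (by linarith)]
    exact hT
  · have h' := H.e_succ_lt h
    rw [← neg_sub (e i) (e k), ← neg_sub (e (k + 1)) (e (i + 1)), div_neg, div_neg, neg_le_neg_iff,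
      div_le_div_iff₀ (by linarith) (by linarith)]
    linarith

end CriticalOrbit

/-! ### Transformation of velocities and auxiliary inequalities -/

/-- How the velocity of a Poincaré coordinate changes under `a ↦ c * a ^ α + d`. -/
lemma crossVel_rpow {α τ c d a₀ a₁ a₂ l₀ l₁ l₂ b₀ b₁ b₂ m₀ m₁ m₂ : ℝ} (hα : 1 < α) (hc : c ≠ 0)
    (h₀ : 0 ≤ a₀) (h₁ : 0 ≤ a₁) (h₂ : 0 ≤ a₂) (h02 : a₀ ≠ a₂) (h12 : a₁ ≠ a₂)
    (hb₀ : b₀ = c * a₀ ^ α + d) (hb₁ : b₁ = c * a₁ ^ α + d) (hb₂ : b₂ = c * a₂ ^ α + d)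
    (hm₀ : b₀ * m₀ = c * a₀ ^ α * (α * l₀ + τ)) (hm₁ : b₁ * m₁ = c * a₁ ^ α * (α * l₁ + τ))
    (hm₂ : b₂ * m₂ = c * a₂ ^ α * (α * l₂ + τ)) :
    crossVel b₀ b₁ b₂ m₀ m₁ m₂ = crossVel a₀ a₁ a₂ l₀ l₁ l₂ +
      logDefect α a₁ a₂ * (l₁ - l₂) + logDefect α a₀ a₂ * (l₂ - l₀) := by
  have n1 := sub_ne_zero.2 (rpow_ne_of_ne hα h₁ h₂ h12)
  have n0 := sub_ne_zero.2 (rpow_ne_of_ne hα h₀ h₂ h02)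
  have k1 : b₁ - b₂ = c * (a₁ ^ α - a₂ ^ α) := by rw [hb₁, hb₂]; ring
  have k0 : b₀ - b₂ = c * (a₀ ^ α - a₂ ^ α) := by rw [hb₀, hb₂]; ring
  have n1' : b₁ - b₂ ≠ 0 := by rw [k1]; exact mul_ne_zero hc n1
  have n0' : b₀ - b₂ ≠ 0 := by rw [k0]; exact mul_ne_zero hc n0
  have s1 : b₁ * (m₁ - m₂) / (b₁ - b₂) = (b₁ * m₁ - b₂ * m₂) / (b₁ - b₂) - m₂ := by
    field_simp; ring
  have s0 : b₀ * (m₂ - m₀) / (b₂ - b₀) = (b₀ * m₀ - b₂ * m₂) / (b₀ - b₂) - m₂ := by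
    rw [← neg_sub b₀ b₂, div_neg]
    field_simp; ring
  have t1 : (b₁ * m₁ - b₂ * m₂) / (b₁ - b₂) = τ + α * l₂ +
      α * a₁ ^ α / (a₁ ^ α - a₂ ^ α) * (l₁ - l₂) := by
    rw [hm₁, hm₂, k1]; field_simp; ring
  have t0 : (b₀ * m₀ - b₂ * m₂) / (b₀ - b₂) = τ + α * l₂ +
      α * a₀ ^ α / (a₀ ^ α - a₂ ^ α) * (l₀ - l₂) := by
    rw [hm₀, hm₂, k0]; field_simp; ring
  unfold crossVel logDefect
  rw [s1, s0, t1, t0, ← neg_sub a₀ a₂, div_neg]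
  ring

/-- The relative velocities of p < x < q have two degrees of freedom. Here a (Poincaré coordinate of
x) and B (length q - p) serve as coordinates on them. -/
lemma crossVel_solve {p x q lp lx lq a B : ℝ} (hp : 0 ≤ p) (hpx : p < x) (hxq : x < q)
    (ha : a = crossVel p q x lp lq lx) (hB : q * (lq - lp) = (q - p) * B) :
    lx - lp = (1 - p / x) * (B - (q - x) / (q - p) * a) ∧
      q * (lq - lx) / (q - x) = a + p / x * (B - (q - x) / (q - p) * a) := by
  have hx : 0 < x := by linarith
  have h1 : 0 < x - p := by linarith
  have h2 : 0 < q - x := by linarith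
  have h3 : 0 < q - p := by linarith
  unfold crossVel at ha
  have hW : q * (lq - lx) = (q - p) * B - q * (lx - lp) := by linarith
  have h : lx - lp = (1 - p / x) * (B - (q - x) / (q - p) * a) := by
    rw [ha, hW]; field_simp; ring
  refine ⟨h, ?_⟩
  have h' : p * (lx - lp) / (x - p) = p / x * (B - (q - x) / (q - p) * a) := by
    rw [h]; field_simp
  rw [← h', ha]; ring

/-- The right side is (1-κ)a + κB, an average of quantities at least m, plus the nonnegative
κ(1-r)a. -/
lemma le_add_mul_sub {m a B r κ : ℝ} (ha : 0 ≤ a) (hr : r ≤ 1) (h0 : 0 ≤ κ) (h1 : κ ≤ 1)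
    (hma : m ≤ a) (hmB : m ≤ B) : m ≤ a + κ * (B - r * a) := by
  nlinarith [mul_nonneg (sub_nonneg.2 h1) (sub_nonneg.2 hma), mul_nonneg h0 (sub_nonneg.2 hmB),
    mul_nonneg h0 (mul_nonneg (sub_nonneg.2 hr) ha)]

/-- Meant for x the image of q under the second iterate, with z = ζ(q). Positivity of αl_x + τ gives
-l_x < τ/α, so αz(αl_x + τ) ≤ τ(1 + 1/α). Multiplying by (α-1)/α leaves τ(1 - 1/α²). -/
lemma sub_one_mul_le_of_pos {α τ x lx z θq : ℝ} (hα : 1 < α) (hτ : 0 ≤ τ) (hx : 0 ≤ x)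
    (hz : 0 ≤ z) (h : α * z * θq = τ - x * lx / (1 + x)) (hθ : α * lx + τ ≤ θq)
    (hpos : 0 < α * lx + τ) : (α - 1) * z * (α * lx + τ) ≤ τ := by
  have h1 : -(x * lx / (1 + x)) ≤ τ / α := by
    have e : -(x * lx / (1 + x)) = x / (1 + x) * (-lx) := by ring
    rw [e]
    have h2 : -lx ≤ τ / α := by
      rw [le_div_iff₀ (by linarith)]; linarith
    have h3 : 0 ≤ x / (1 + x) := by positivity
    have h4 : x / (1 + x) ≤ 1 := by rw [div_le_one (by linarith)]; linarith
    have h5 : 0 ≤ τ / α := div_nonneg hτ (by linarith)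
    nlinarith
  have h2 : α * z * (α * lx + τ) ≤ τ + τ / α := by
    have : α * z * (α * lx + τ) ≤ α * z * θq :=
      mul_le_mul_of_nonneg_left hθ (mul_nonneg (by linarith) hz)
    linarith
  have h3 : (α - 1) / α * (α * z * (α * lx + τ)) ≤ (α - 1) / α * (τ + τ / α) :=
    mul_le_mul_of_nonneg_left h2 (div_nonneg (by linarith) (by linarith))
  have hα0 : 0 < α := by linarith
  have e1 : (α - 1) / α * (α * z * (α * lx + τ)) = (α - 1) * z * (α * lx + τ) := by
    field_simp
  have e2 : (α - 1) / α * (τ + τ / α) = τ - τ / α ^ 2 := by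
    field_simp; ring
  have : 0 ≤ τ / α ^ 2 := by positivity
  linarith

namespace CriticalOrbit

variable {α t : ℝ} {e o : ℕ → ℝ}

lemma e_ne_add_two (H : CriticalOrbit α t e o) (j : ℕ) : e j ≠ e (j + 2) := by
  rcases Nat.even_or_odd j with h | ⟨m, rfl⟩
  · exact (H.lt_of_even h).1.ne
  · exact (H.lt_of_even' (even_two_mul m)).2.ne'

lemma e_ne_succ (H : CriticalOrbit α t e o) (j : ℕ) : e (j + 1) ≠ e (j + 2) := by
  rcases Nat.even_or_odd j with h | ⟨m, rfl⟩
  · exact (H.lt_of_even h).2.ne'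
  · exact (H.lt_of_even' (even_two_mul m)).1.ne

lemma o_ne (H : CriticalOrbit α t e o) {i k : ℕ} (h : e i ≠ e k) : o i ≠ o k := by
  rcases h.lt_or_gt with h | h
  · exact (H.o_lt h).ne'
  · exact (H.o_lt h).ne

end CriticalOrbit

/-! ### Logarithmic velocities along the orbit and the inductive bounds -/

/-- `crossVel` of three consecutive terms. -/
def vel (a l : ℕ → ℝ) (j : ℕ) : ℝ :=
  crossVel (a j) (a (j + 1)) (a (j + 2)) (l j) (l (j + 1)) (l (j + 2))

/-- Relative logarithmic velocity of two consecutive terms. -/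
def pairVel (a l : ℕ → ℝ) (j : ℕ) : ℝ := a (j + 1) * (l (j + 1) - l j) / (a (j + 1) - a j)

/-- Logarithmic velocities `l` of `e` and `L` of `o` along a critical orbit, with the parameter
moving so that `t' = t * (2 - t) / 2`. The value `l 0` is a convention. -/
structure LogVelocity (α t : ℝ) (e o l L : ℕ → ℝ) : Prop extends CriticalOrbit α t e o where
  L_eq : ∀ j, L j = -(zeta α t (e j) * (α * l j + (2 - t) / 2))
  l_succ : ∀ j, e (j + 1) * l (j + 1) = (1 + e (j + 1)) * ((2 - t) / 2 + α * L j)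
  l_zero : l 0 = l 1 - vel e l 0

namespace LogVelocity

variable {α t : ℝ} {e o l L : ℕ → ℝ}

lemma vel_odd (H : LogVelocity α t e o l L) (j : ℕ) :
    vel o L j = vel e l j + logDefect α (e (j + 1)) (e (j + 2)) * (l (j + 1) - l (j + 2)) +
      logDefect α (e j) (e (j + 2)) * (l (j + 2) - l j) := by
  have ht := H.one_lt
  have hm : ∀ i, o i * L i = -t * e i ^ α * (α * l i + (2 - t) / 2) := fun i => by
    have := H.o_pos i
    rw [H.L_eq, H.zeta_eq]
    field_simp
  have ho : ∀ i, o i = -t * e i ^ α + 1 := fun i => by rw [H.o_eq]; ring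
  exact crossVel_rpow H.one_lt_exp (by linarith) (H.e_nonneg _) (H.e_nonneg _) (H.e_nonneg _)
    (H.e_ne_add_two j) (H.e_ne_succ j) (ho _) (ho _) (ho _) (hm _) (hm _) (hm _)

lemma vel_even_succ (H : LogVelocity α t e o l L) (j : ℕ) :
    vel e l (j + 1) = vel o L j +
      logDefect α (o (j + 1)) (o (j + 2)) * (L (j + 1) - L (j + 2)) +
      logDefect α (o j) (o (j + 2)) * (L (j + 2) - L j) := by
  have ht := H.one_lt
  have hm : ∀ i, e (i + 1) * l (i + 1) = t * o i ^ α * (α * L i + (2 - t) / 2) := fun i => by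
    rw [H.l_succ, H.e_succ]; ring
  have ho : ∀ i, e (i + 1) = t * o i ^ α + -1 := fun i => by rw [H.e_succ]; ring
  exact crossVel_rpow H.one_lt_exp (by linarith) (H.o_pos _).le (H.o_pos _).le (H.o_pos _).le
    (H.o_ne (H.e_ne_add_two j)) (H.o_ne (H.e_ne_succ j)) (ho _) (ho _) (ho _) (hm _) (hm _) (hm _)

/-- The logarithmic velocity of 1 + e_(j+1) = t·o_j^α, computed in two ways. -/
lemma mul_L (H : LogVelocity α t e o l L) (j : ℕ) :
    α * L j = e (j + 1) * l (j + 1) / (1 + e (j + 1)) - (2 - t) / 2 := by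
  have := H.e_succ_pos j
  rw [H.l_succ]
  field_simp
  ring

lemma l_sub_eq (H : LogVelocity α t e o l L) {j : ℕ} (hj : Even j) :
    l (j + 2) - l j = (1 - e j / e (j + 2)) *
      (pairVel e l j - (e (j + 1) - e (j + 2)) / (e (j + 1) - e j) * vel e l j) ∧
    e (j + 1) * (l (j + 1) - l (j + 2)) / (e (j + 1) - e (j + 2)) = vel e l j +
      e j / e (j + 2) *
      (pairVel e l j - (e (j + 1) - e (j + 2)) / (e (j + 1) - e j) * vel e l j) := by
  obtain ⟨h1, h2⟩ := H.lt_of_even hj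
  refine crossVel_solve (H.e_nonneg j) h1 h2 rfl ?_
  have : 0 < e (j + 1) - e j := by linarith
  unfold pairVel
  field_simp

/-- The bounds that hold for the even indices `j`. -/
structure Bounds (α t : ℝ) (e l : ℕ → ℝ) (j : ℕ) : Prop where
  vel_ge : vel e l 0 - (2 - t) / 2 * (zeta α t (e j) / zeta α t (e (j + 1))) ≤ vel e l j
  pair_ge : vel e l 0 - (2 - t) / 2 * (zeta α t (e j) / zeta α t (e (j + 1))) ≤ pairVel e l j
  vel_add_ge : l 1 - (2 - t) / 2 * (zeta α t (e j) / zeta α t (e (j + 1))) ≤ vel e l j + l j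
  pair_add_ge : l 1 ≤ pairVel e l j + l j

lemma l_one (H : LogVelocity α t e o l L) : (t - 1) * l 1 = t * ((2 - t) / 2) := by
  have h := H.l_succ 0
  have hα := H.one_lt_exp
  have hL : L 0 = 0 := by
    rw [H.L_eq, zeta, H.e_zero, Real.zero_rpow (by linarith)]; simp
  rw [H.e_one, hL] at h
  linarith

lemma lt_l_one (H : LogVelocity α t e o l L) : (2 - t) / 2 < l 1 := by
  have h := H.l_one
  have h1 := H.one_lt
  have h2 := H.lt_two
  by_contra! hc
  nlinarith

/-- As e_0 = 0, the value l_0 is free and does not affect `vel e l 0`. The convention for l_0 makes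
all four bounds equalities at index 0. -/
lemma bounds_zero (H : LogVelocity α t e o l L) : Bounds α t e l 0 := by
  have hα := H.one_lt_exp
  have hz : zeta α t (e 0) = 0 := by
    rw [zeta, H.e_zero, Real.zero_rpow (by linarith)]; simp
  have he : 0 < e 1 := H.e_succ_pos 0
  have h0 := H.l_zero
  have hB : pairVel e l 0 = vel e l 0 := by
    unfold pairVel
    rw [h0, H.e_zero, zero_add, sub_zero, sub_sub_cancel, mul_div_cancel_left₀ _ he.ne']
  constructor
  · simp [hz]
  · simp [hz, hB]
  · rw [hz, zero_div, mul_zero]; linarith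
  · linarith

/-- Consequences of the bounds at an even index. -/
lemma Bounds.pos (H : LogVelocity α t e o l L) {j : ℕ} (hj : Even j) (hM : 2 - t < vel e l 0)
    (hb : Bounds α t e l j) : 0 < vel e l j ∧ 0 < pairVel e l j ∧ 0 < vel e l j + l j ∧
      0 < pairVel e l j + l j ∧ vel e l 0 - (2 - t) / 2 ≤ vel e l j ∧
      vel e l 0 - (2 - t) / 2 ≤ pairVel e l j := by
  have h := H.lt_l_one
  have h2 := H.lt_two
  obtain ⟨h3, h4⟩ := H.lt_of_even hj
  have hz : zeta α t (e j) / zeta α t (e (j + 1)) ≤ 1 := by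
    rw [div_le_one (H.zeta_pos j)]
    exact (H.zeta_lt (h3.trans h4)).le
  have hz' : (2 - t) / 2 * (zeta α t (e j) / zeta α t (e (j + 1))) ≤ (2 - t) / 2 * 1 :=
    mul_le_mul_of_nonneg_left hz (by linarith)
  have b1 := hb.vel_ge
  have b2 := hb.pair_ge
  have b3 := hb.vel_add_ge
  have b4 := hb.pair_add_ge
  refine ⟨?_, ?_, ?_, ?_, ?_, ?_⟩ <;> linarith

/-- `l` decreases from index `j + 1` to `j + 2`. -/
lemma l_le (H : LogVelocity α t e o l L) {j : ℕ} (hj : Even j) (ha : 0 < vel e l j)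
    (hB : 0 < pairVel e l j) : l (j + 2) ≤ l (j + 1) := by
  obtain ⟨h1, h2⟩ := H.lt_of_even hj
  obtain ⟨-, h⟩ := H.l_sub_eq hj
  have h0 := H.e_nonneg j
  have hr : (e (j + 1) - e (j + 2)) / (e (j + 1) - e j) ≤ 1 := by
    rw [div_le_one (by linarith)]; linarith
  have hρ : e j / e (j + 2) ≤ 1 := by rw [div_le_one (by linarith)]; linarith
  have h3 := le_add_mul_sub ha.le hr (div_nonneg h0 (by linarith)) hρ ha.le hB.le
  rw [← h] at h3
  by_contra! hc
  have : e (j + 1) * (l (j + 1) - l (j + 2)) / (e (j + 1) - e (j + 2)) < 0 :=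
    div_neg_of_neg_of_pos (mul_neg_of_pos_of_neg (by linarith) (by linarith)) (by linarith)
  linarith

/-- The loss in the step is bounded by the half-speed `(2 - t) / 2`. -/
lemma loss_le (H : LogVelocity α t e o l L) {j : ℕ} (hj : Even j) (ha : 0 < vel e l j)
    (hB : 0 < pairVel e l j) {c : ℝ} (hc0 : 0 ≤ c) :
    (α * l (j + 2) + (2 - t) / 2) * c ≤
      (2 - t) / 2 * (c / ((α - 1) * zeta α t (e (j + 1)))) := by
  have hα := H.one_lt_exp
  have hz := H.zeta_pos j
  have hτ : 0 ≤ (2 - t) / 2 := by linarith [H.lt_two]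
  have hp : 0 < (α - 1) * zeta α t (e (j + 1)) := mul_pos (by linarith) hz
  rcases le_or_gt (α * l (j + 2) + (2 - t) / 2) 0 with h | h
  · have h1 : (α * l (j + 2) + (2 - t) / 2) * c ≤ 0 := mul_nonpos_of_nonpos_of_nonneg h hc0
    have h2 : 0 ≤ (2 - t) / 2 * (c / ((α - 1) * zeta α t (e (j + 1)))) := by positivity
    linarith
  · have h1 := H.mul_L (j + 1)
    rw [H.L_eq] at h1
    have hl := H.l_le hj ha hB
    have h2 := sub_one_mul_le_of_pos (α := α) (τ := (2 - t) / 2) (x := e (j + 2)) (lx := l (j + 2))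
      (z := zeta α t (e (j + 1))) (θq := α * l (j + 1) + (2 - t) / 2) hα hτ (H.e_nonneg _) hz.le
      (by linarith) (by nlinarith) h
    rw [← mul_div_assoc, le_div_iff₀ hp]
    nlinarith

/-- The power term is nonpositive and is dropped. The resulting bound is the admissible range of K
in `le_vel_add_mul`. -/
lemma logDefect_le_div (H : LogVelocity α t e o l L) {i k : ℕ} (h : e i < e k) :
    logDefect α (e i) (e k) ≤ e i / (e k - e i) := by
  unfold logDefect
  have hα := H.one_lt_exp
  have h1 := Real.rpow_lt_rpow (H.e_nonneg i) h (by linarith : 0 < α)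
  have h2 : α * e i ^ α / (e i ^ α - e k ^ α) ≤ 0 :=
    div_nonpos_of_nonneg_of_nonpos (mul_nonneg (by linarith) (Real.rpow_nonneg (H.e_nonneg i) α))
      (by linarith)
  rw [← neg_sub (e k) (e i), div_neg]
  linarith

/-- Lower bound for `vel e l j + K * (l (j + 2) - l j)` when `0 ≤ K ≤ e j / (e (j + 2) - e j)`. -/
lemma le_vel_add_mul (H : LogVelocity α t e o l L) {j : ℕ} (hj : Even j) (ha : 0 < vel e l j)
    {K m : ℝ} (hK : 0 ≤ K) (hK' : K ≤ e j / (e (j + 2) - e j))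
    (h1 : m ≤ vel e l j) (h2 : m ≤ pairVel e l j) : m ≤ vel e l j + K * (l (j + 2) - l j) := by
  obtain ⟨h3, h4⟩ := H.lt_of_even hj
  have h0 := H.e_nonneg j
  have hx : 0 < e (j + 2) := by linarith
  have hr : (e (j + 1) - e (j + 2)) / (e (j + 1) - e j) ≤ 1 := by
    rw [div_le_one (by linarith)]; linarith
  rw [(H.l_sub_eq hj).1, ← mul_assoc]
  have hx' : 0 < e (j + 2) - e j := by linarith
  have e1 : e j / (e (j + 2) - e j) * (1 - e j / e (j + 2)) = e j / e (j + 2) := by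
    field_simp
  have hρ : e j / e (j + 2) ≤ 1 := by rw [div_le_one hx]; linarith
  have h5 : K * (1 - e j / e (j + 2)) ≤ e j / (e (j + 2) - e j) * (1 - e j / e (j + 2)) :=
    mul_le_mul_of_nonneg_right hK' (by linarith)
  exact le_add_mul_sub ha.le hr (mul_nonneg hK (by linarith)) (by linarith) h1 h2

/-- Adding l_(j+2) - l_j raises the coefficient to K + 1, and (K+1)(1 - e_j/e_(j+2)) ≤ 1 still
holds, so the averaging argument survives. -/
lemma le_vel_add_add_mul (H : LogVelocity α t e o l L) {j : ℕ} (hj : Even j) (ha : 0 < vel e l j)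
    {K m : ℝ} (hK : 0 ≤ K) (hK' : K ≤ e j / (e (j + 2) - e j))
    (h1 : m ≤ vel e l j + l j) (h2 : m ≤ pairVel e l j + l j) :
    m ≤ vel e l j + K * (l (j + 2) - l j) + l (j + 2) := by
  obtain ⟨h3, h4⟩ := H.lt_of_even hj
  have h0 := H.e_nonneg j
  have hx : 0 < e (j + 2) := by linarith
  have hr : (e (j + 1) - e (j + 2)) / (e (j + 1) - e j) ≤ 1 := by
    rw [div_le_one (by linarith)]; linarith
  have e0 : vel e l j + K * (l (j + 2) - l j) + l (j + 2) =
    vel e l j + (K + 1) * (l (j + 2) - l j) + l j := by ring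
  rw [e0, (H.l_sub_eq hj).1, ← mul_assoc]
  have hx' : 0 < e (j + 2) - e j := by linarith
  have e1 : e j / (e (j + 2) - e j) * (1 - e j / e (j + 2)) = e j / e (j + 2) := by
    field_simp
  have hρ : e j / e (j + 2) ≤ 1 := by rw [div_le_one hx]; linarith
  have h5 : K * (1 - e j / e (j + 2)) ≤ e j / (e (j + 2) - e j) * (1 - e j / e (j + 2)) :=
    mul_le_mul_of_nonneg_right hK' (by linarith)
  have := le_add_mul_sub (m := m - l j) (κ := (K + 1) * (1 - e j / e (j + 2)))
    ha.le hr (mul_nonneg (by linarith) (by linarith)) (by linarith) (by linarith)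
    (by linarith : m - l j ≤ pairVel e l j)
  linarith

lemma vel_odd_ge (H : LogVelocity α t e o l L) {j : ℕ} (hj : Even j) (ha : 0 < vel e l j)
    (hB : 0 < pairVel e l j) {m : ℝ} (h1 : m ≤ vel e l j) (h2 : m ≤ pairVel e l j) :
    m ≤ vel o L j := by
  obtain ⟨h3, h4⟩ := H.lt_of_even hj
  rw [H.vel_odd]
  have h5 := H.le_vel_add_mul hj ha
    (logDefect_nonneg H.one_lt_exp (H.e_nonneg j) (H.e_nonneg _) h3.ne) (H.logDefect_le_div h3) h1 h2
  have h6 := mul_nonneg (logDefect_nonneg H.one_lt_exp (H.e_nonneg _) (H.e_nonneg _) h4.ne')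
    (sub_nonneg.2 (H.l_le hj ha hB))
  linarith

lemma L_sub_eq (H : LogVelocity α t e o l L) (i k : ℕ) :
    L k - L i = -((zeta α t (e k) - zeta α t (e i)) * (α * l k + (2 - t) / 2)) -
      α * zeta α t (e i) * (l k - l i) := by
  rw [H.L_eq, H.L_eq]; ring

/-- The defect of the second iterate. -/
lemma defect_bounds (H : LogVelocity α t e o l L) {j : ℕ} (hj : Even j) :
    0 ≤ logDefect α (e j) (e (j + 2)) -
        α * zeta α t (e j) * logDefect α (o j) (o (j + 2)) ∧
      logDefect α (e j) (e (j + 2)) - α * zeta α t (e j) * logDefect α (o j) (o (j + 2)) ≤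
        e j / (e (j + 2) - e j) := by
  obtain ⟨h3, h4⟩ := H.lt_of_even hj
  refine ⟨H.logDefect_sub_nonneg h3.ne, ?_⟩
  have h5 := H.logDefect_le_div h3
  have h6 := logDefect_nonneg H.one_lt_exp (H.o_pos j).le (H.o_pos (j + 2)).le (H.o_lt h3).ne'
  have hα := H.one_lt_exp
  have h7 := mul_nonneg (mul_nonneg (by linarith : 0 ≤ α) (H.zeta_nonneg j)) h6
  linarith

/-- Over the two maps, the corrections proportional to differences of l have nonnegative or
controlled coefficients by concavity. The rest is (αl_(j+2) + τ)·c with 0 ≤ c ≤ (α-1)ζ_(j+1), so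
`loss_le` bounds the loss by τ = (2-t)/2. -/
lemma vel_even_succ_ge (H : LogVelocity α t e o l L) {j : ℕ} (hj : Even j) (ha : 0 < vel e l j)
    (hB : 0 < pairVel e l j) {m : ℝ} (h1 : m ≤ vel e l j) (h2 : m ≤ pairVel e l j) :
    m - (2 - t) / 2 ≤ vel e l (j + 1) := by
  have hα := H.one_lt_exp
  obtain ⟨h3, h4⟩ := H.lt_of_even hj
  obtain ⟨k1, k2⟩ := H.defect_bounds hj
  have hW := H.l_le hj ha hB
  have h5 := H.le_vel_add_mul hj ha k1 k2 h1 h2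
  have h6 := mul_nonneg (H.logDefect_sub_nonneg h4.ne') (sub_nonneg.2 hW)
  set E1 := logDefect α (o (j + 1)) (o (j + 2)) with hE1
  set E2 := logDefect α (o j) (o (j + 2)) with hE2
  have a1 : 0 ≤ E1 := logDefect_nonneg hα (H.o_pos _).le (H.o_pos _).le (H.o_lt h4).ne
  have a2 : 0 ≤ E2 := logDefect_nonneg hα (H.o_pos _).le (H.o_pos _).le (H.o_lt h3).ne'
  have b1 : E1 ≤ α - 1 := logDefect_le hα (H.o_pos _).le (H.o_pos _).le (H.o_lt h4).ne
  have b2 : E2 ≤ α - 1 := logDefect_le hα (H.o_pos _).le (H.o_pos _).le (H.o_lt h3).ne'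
  have z1 := H.zeta_lt h3
  have z2 := H.zeta_lt h4
  have z0 := H.zeta_nonneg j
  set c := E1 * (zeta α t (e (j + 1)) - zeta α t (e (j + 2))) +
    E2 * (zeta α t (e (j + 2)) - zeta α t (e j)) with hc
  have hc0 : 0 ≤ c := by
    have := mul_nonneg a1 (sub_nonneg.2 z2.le)
    have := mul_nonneg a2 (sub_nonneg.2 z1.le)
    linarith
  have hc1 : c ≤ (α - 1) * zeta α t (e (j + 1)) := by
    have := mul_le_mul_of_nonneg_right b1 (sub_nonneg.2 z2.le)
    have := mul_le_mul_of_nonneg_right b2 (sub_nonneg.2 z1.le)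
    have := mul_nonneg (by linarith : 0 ≤ α - 1) z0
    linarith
  have hl := H.loss_le hj ha hB hc0
  have hτ : 0 ≤ (2 - t) / 2 := by linarith [H.lt_two]
  have hfr : c / ((α - 1) * zeta α t (e (j + 1))) ≤ 1 :=
    div_le_one_of_le₀ hc1 (mul_nonneg (by linarith) (H.zeta_nonneg _))
  have hl' := mul_le_mul_of_nonneg_left hfr hτ
  rw [H.vel_even_succ, H.vel_odd, H.L_sub_eq j (j + 2), ← neg_sub (L (j + 2)) (L (j + 1)),
    H.L_sub_eq (j + 1) (j + 2)]
  linarith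

lemma pairVel_add_two (H : LogVelocity α t e o l L) {j : ℕ} (hj : Even j) :
    pairVel e l (j + 2) = (e (j + 1) - e (j + 3)) / (e (j + 1) - e (j + 2)) * vel e l (j + 1) +
      (vel e l j + e j / e (j + 2) *
      (pairVel e l j - (e (j + 1) - e (j + 2)) / (e (j + 1) - e j) * vel e l j)) := by
  rw [← (H.l_sub_eq hj).2]
  obtain ⟨h3, h4⟩ := H.lt_of_even hj
  obtain ⟨h5, h6⟩ := H.lt_of_even' hj
  have n1 : e (j + 1) - e (j + 2) ≠ 0 := by linarith
  have n2 : e (j + 2) - e (j + 3) ≠ 0 := by linarith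
  have n3 : e (j + 3) - e (j + 1) ≠ 0 := by linarith
  unfold pairVel vel crossVel
  simp only [add_assoc, Nat.reduceAdd]
  rw [← neg_sub (e (j + 2)) (e (j + 3)), ← neg_sub (e (j + 3)) (e (j + 1))]
  field_simp
  ring

end LogVelocity

/-! ### The inductive step from j to j + 2 -/

namespace LogVelocity

variable {α t : ℝ} {e o l L : ℕ → ℝ}

lemma mul_L_succ_sub (H : LogVelocity α t e o l L) (i : ℕ) :
    α * (L (i + 1) - L i) = (e (i + 2) - e (i + 1)) * (pairVel e l (i + 1) + l (i + 1) +
      e (i + 1) * pairVel e l (i + 1)) / ((1 + e (i + 2)) * (1 + e (i + 1))) := by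
  have h1 := H.e_succ_pos i
  have h2 := H.e_succ_pos (i + 1)
  have h3 := sub_ne_zero.2 (H.e_ne_succ i).symm
  rw [mul_sub, H.mul_L, H.mul_L]
  unfold pairVel
  simp only [add_assoc, Nat.reduceAdd] at h2 ⊢
  field_simp
  ring

/-- Both this and `mul_L_succ_sub` display the sign of a velocity difference: every factor is
positive once `vel`, `pairVel` and `pairVel + l` are. -/
lemma mul_L_sub_succ (H : LogVelocity α t e o l L) {j : ℕ} (hj : Even j) :
    α * (L j - L (j + 1)) = (e (j + 1) - e (j + 2)) * (pairVel e l j + l j + e j * pairVel e l j +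
      (1 + e (j + 1)) * ((e (j + 2) - e j) / (e (j + 1) - e j)) * vel e l j) /
      ((1 + e (j + 1)) * (1 + e (j + 2))) := by
  obtain ⟨h3, h4⟩ := H.lt_of_even hj
  have h0 := H.e_nonneg j
  have hx : 0 < e (j + 2) := by linarith
  have h1 : 0 < 1 + e (j + 1) := by linarith
  have h2 : 0 < 1 + e (j + 2) := by linarith
  have n1 : e (j + 1) - e (j + 2) ≠ 0 := by linarith
  have n2 : e (j + 1) - e j ≠ 0 := by linarith
  obtain ⟨e1, e2⟩ := H.l_sub_eq hj
  rw [mul_sub, H.mul_L, H.mul_L]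
  set a := vel e l j
  set B := pairVel e l j
  have hx2 : l (j + 2) = l j + (1 - e j / e (j + 2)) *
      (B - (e (j + 1) - e (j + 2)) / (e (j + 1) - e j) * a) := by linarith
  rw [div_eq_iff n1] at e2
  have hq : e (j + 1) * l (j + 1) = e (j + 1) * l (j + 2) + (a + e j / e (j + 2) *
      (B - (e (j + 1) - e (j + 2)) / (e (j + 1) - e j) * a)) * (e (j + 1) - e (j + 2)) := by
    linarith
  rw [hq]
  simp only [add_assoc, Nat.reduceAdd]
  rw [hx2]
  field_simp
  ring

lemma pairVel_add_two_ge (H : LogVelocity α t e o l L) {j : ℕ} (hj : Even j)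
    (ha : 0 < vel e l j) (ha' : 0 ≤ vel e l (j + 1)) {m : ℝ} (h1 : m ≤ vel e l j)
    (h2 : m ≤ pairVel e l j) : m ≤ pairVel e l (j + 2) := by
  obtain ⟨h3, h4⟩ := H.lt_of_even hj
  obtain ⟨h5, h6⟩ := H.lt_of_even' hj
  have h0 := H.e_nonneg j
  have hr : (e (j + 1) - e (j + 2)) / (e (j + 1) - e j) ≤ 1 := by
    rw [div_le_one (by linarith)]; linarith
  have hρ : e j / e (j + 2) ≤ 1 := by rw [div_le_one (by linarith)]; linarith
  have h7 := le_add_mul_sub ha.le hr (div_nonneg h0 (by linarith)) hρ h1 h2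
  have h8 := mul_nonneg (div_nonneg (by linarith : 0 ≤ e (j + 1) - e (j + 3))
    (by linarith : 0 ≤ e (j + 1) - e (j + 2))) ha'
  rw [H.pairVel_add_two hj]
  linarith

lemma pairVel_add_two_add_ge (H : LogVelocity α t e o l L) {j : ℕ} (hj : Even j)
    (ha : 0 < vel e l j) (ha' : 0 ≤ vel e l (j + 1)) :
    pairVel e l j + l j ≤ pairVel e l (j + 2) + l (j + 2) := by
  obtain ⟨h3, h4⟩ := H.lt_of_even hj
  obtain ⟨h5, h6⟩ := H.lt_of_even' hj
  have hr : (e (j + 1) - e (j + 2)) / (e (j + 1) - e j) ≤ 1 := by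
    rw [div_le_one (by linarith)]; linarith
  have h7 := mul_nonneg (sub_nonneg.2 hr) ha.le
  have h8 := mul_nonneg (div_nonneg (by linarith : 0 ≤ e (j + 1) - e (j + 3))
    (by linarith : 0 ≤ e (j + 1) - e (j + 2))) ha'
  rw [H.pairVel_add_two hj]
  linarith [(H.l_sub_eq hj).1]

/-- The four maps leading from e at j to e at j + 2 are composed, and corrections are grouped so
that the last four terms are differences of defects, accessible to monotonicity. -/
lemma vel_add_two_eq (H : LogVelocity α t e o l L) (j : ℕ) :
    vel e l (j + 2) = vel e l j +
      (logDefect α (e j) (e (j + 2)) - α * zeta α t (e j) * logDefect α (o j) (o (j + 2))) *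
        (l (j + 2) - l j) -
      (α * l (j + 2) + (2 - t) / 2) *
        (logDefect α (o j) (o (j + 2)) * (zeta α t (e (j + 2)) - zeta α t (e j))) +
      (logDefect α (e (j + 1)) (e (j + 2)) - logDefect α (e (j + 1)) (e (j + 3))) *
        (l (j + 1) - l (j + 2)) +
      (logDefect α (e (j + 1)) (e (j + 3)) - logDefect α (e (j + 2)) (e (j + 3))) *
        (l (j + 3) - l (j + 2)) +
      (logDefect α (o (j + 1)) (o (j + 3)) - logDefect α (o (j + 1)) (o (j + 2))) *
        (L (j + 2) - L (j + 1)) +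
      (logDefect α (o (j + 2)) (o (j + 3)) - logDefect α (o (j + 1)) (o (j + 3))) *
        (L (j + 2) - L (j + 3)) := by
  have h1 := H.vel_even_succ (j + 1)
  have h2 := H.vel_odd (j + 1)
  have h3 := H.vel_even_succ j
  have h4 := H.vel_odd j
  have h5 := H.L_sub_eq j (j + 2)
  simp only [add_assoc, Nat.reduceAdd] at h1 h2
  rw [h1, h2, h3, h4, h5]
  ring

lemma vel_add_two_ge (H : LogVelocity α t e o l L) {j : ℕ} (hj : Even j)
    (ha : 0 < vel e l j) (hB : 0 < pairVel e l j) (hB' : 0 < pairVel e l (j + 2))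
    (hl' : 0 < pairVel e l (j + 2) + l (j + 2))
    {m : ℝ} (hm : 0 < m)
    (hmb : m ≤ vel e l j + (logDefect α (e j) (e (j + 2)) -
      α * zeta α t (e j) * logDefect α (o j) (o (j + 2))) * (l (j + 2) - l j) -
      (α * l (j + 2) + (2 - t) / 2) *
        (logDefect α (o j) (o (j + 2)) * (zeta α t (e (j + 2)) - zeta α t (e j)))) :
    m ≤ vel e l (j + 2) := by
  have hα := H.one_lt_exp
  obtain ⟨h3, h4⟩ := H.lt_of_even hj
  obtain ⟨h5, h6⟩ := H.lt_of_even' hj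
  have hj2 : Even (j + 2) := hj.add even_two
  obtain ⟨h7, h8⟩ := H.lt_of_even hj2
  simp only [add_assoc, Nat.reduceAdd] at h7 h8
  have t1 := mul_nonneg (sub_nonneg.2 (logDefect_anti_right hα (H.e_nonneg (j + 2)) h5.le h6))
    (sub_nonneg.2 (H.l_le hj ha hB))
  have hY : 0 ≤ l (j + 3) - l (j + 2) := by
    by_contra! hc
    have : pairVel e l (j + 2) < 0 := by
      unfold pairVel
      simp only [add_assoc, Nat.reduceAdd]
      exact div_neg_of_neg_of_pos (mul_neg_of_pos_of_neg (by linarith [H.e_nonneg j]) hc)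
        (by linarith)
    linarith
  have t2 := mul_nonneg (sub_nonneg.2 (logDefect_swap_le hα (H.e_nonneg (j + 2)) h5 h6)) hY
  have hx : 0 < e (j + 2) := H.e_succ_pos _
  have hD1 : 0 ≤ L (j + 2) - L (j + 1) := by
    have h := H.mul_L_succ_sub (j + 1)
    simp only [add_assoc, Nat.reduceAdd] at h
    have h9 : 0 ≤ α * (L (j + 2) - L (j + 1)) := by
      rw [h]
      refine div_nonneg (mul_nonneg (by linarith) ?_) (mul_nonneg (by linarith) (by linarith))
      have := mul_pos hx hB'
      linarith
    exact nonneg_of_mul_nonneg_right h9 (by linarith)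
  have t3 := mul_nonneg (sub_nonneg.2 (logDefect_anti_right_above hα (H.o_pos (j + 1))
    (H.o_lt h6) (H.o_lt h5).le)) hD1
  have he' : 0 ≤ logDefect α (o (j + 2)) (o (j + 3)) - logDefect α (o (j + 1)) (o (j + 3)) :=
    sub_nonneg.2 (logDefect_swap_le hα (H.o_pos (j + 1)).le (H.o_lt h6) (H.o_lt h5))
  have he'' : logDefect α (o (j + 2)) (o (j + 3)) - logDefect α (o (j + 1)) (o (j + 3)) ≤ α := by
    have := logDefect_le hα (H.o_pos (j + 2)).le (H.o_pos (j + 3)).le (H.o_lt h5).ne'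
    have := logDefect_nonneg hα (H.o_pos (j + 1)).le (H.o_pos (j + 3)).le (H.o_lt h6).ne
    linarith
  set c := logDefect α (o (j + 2)) (o (j + 3)) - logDefect α (o (j + 1)) (o (j + 3)) with hc
  have heq := H.vel_add_two_eq j
  rw [← hc] at heq
  have hge : m + c * (L (j + 2) - L (j + 3)) ≤ vel e l (j + 2) := by linarith
  have hD := H.mul_L_sub_succ hj2
  simp only [add_assoc, Nat.reduceAdd] at hD
  set a := vel e l (j + 2) with hadef
  have hq : 0 < 1 + e (j + 3) := by linarith
  have hx4 : 0 < 1 + e (j + 4) := by linarith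
  have hP : 0 < pairVel e l (j + 2) + (l (j + 2) + e (j + 2) * pairVel e l (j + 2)) := by
    have := mul_pos hx hB'
    linarith
  set s := (e (j + 4) - e (j + 2)) / (e (j + 3) - e (j + 2)) with hs
  have hs0 : 0 ≤ s := div_nonneg (by linarith) (by linarith)
  have hs1 : s ≤ 1 := div_le_one_of_le₀ (by linarith) (by linarith)
  have hDge : (e (j + 3) - e (j + 4)) * s / (1 + e (j + 4)) * a ≤
      α * (L (j + 2) - L (j + 3)) := by
    rw [hD, ← sub_nonneg]
    have : (e (j + 3) - e (j + 4)) * (pairVel e l (j + 2) +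
      (l (j + 2) + (e (j + 2) * pairVel e l (j + 2) + (1 + e (j + 3)) * s * a))) /
      ((1 + e (j + 3)) * (1 + e (j + 4))) - (e (j + 3) - e (j + 4)) * s / (1 + e (j + 4)) * a =
      (e (j + 3) - e (j + 4)) * (pairVel e l (j + 2) + (l (j + 2) +
        e (j + 2) * pairVel e l (j + 2))) / ((1 + e (j + 3)) * (1 + e (j + 4))) := by
      field_simp
      ring
    rw [this]
    exact div_nonneg (mul_nonneg (by linarith) hP.le) (mul_nonneg hq.le hx4.le)
  have hk0 : 0 ≤ (e (j + 3) - e (j + 4)) * s / (1 + e (j + 4)) :=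
    div_nonneg (mul_nonneg (by linarith) hs0) hx4.le
  have hk1 : (e (j + 3) - e (j + 4)) * s / (1 + e (j + 4)) ≤ 1 := by
    rw [div_le_one hx4]
    have := H.e_le (j + 3)
    have := H.lt_two
    have := mul_le_mul_of_nonneg_left hs1 (by linarith : 0 ≤ e (j + 3) - e (j + 4))
    linarith
  set k := (e (j + 3) - e (j + 4)) * s / (1 + e (j + 4)) with hk
  -- The sign of L_(j+2) - L_(j+3) depends on the velocity a being estimated. If a < 0, then k ≤ 1
  -- and c ≤ α give a ≤ c(L_(j+2) - L_(j+3)), hence m + a ≤ a, contradicting m > 0.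
  have ha0 : 0 ≤ a := by
    by_contra! hneg
    have g1 : a ≤ α * (L (j + 2) - L (j + 3)) := by nlinarith
    have g2 : α * a ≤ α * (c * (L (j + 2) - L (j + 3))) := by
      have g3 := mul_le_mul_of_nonneg_left g1 he'
      have g4 : α * a ≤ c * a := mul_le_mul_of_nonpos_right he'' hneg.le
      linarith
    have g5 := le_of_mul_le_mul_left g2 (by linarith)
    linarith
  have hD0 : 0 ≤ L (j + 2) - L (j + 3) :=
    nonneg_of_mul_nonneg_right ((mul_nonneg hk0 ha0).trans hDge) (by linarith)
  have := mul_nonneg he' hD0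
  linarith

lemma bounds_add_two (H : LogVelocity α t e o l L) {j : ℕ} (hj : Even j)
    (hM : 2 - t < vel e l 0) (hb : Bounds α t e l j) : Bounds α t e l (j + 2) := by
  have hα := H.one_lt_exp
  have hτ : 0 < (2 - t) / 2 := by linarith [H.lt_two]
  obtain ⟨ha, hB, hal, hBl, hma, hmB⟩ := hb.pos H hj hM
  obtain ⟨h3, h4⟩ := H.lt_of_even hj
  obtain ⟨h5, h6⟩ := H.lt_of_even' hj
  have ha' : 0 ≤ vel e l (j + 1) := by
    have := H.vel_even_succ_ge hj ha hB hma hmB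
    linarith
  have hB' := H.pairVel_add_two_ge hj ha ha' hb.vel_ge hb.pair_ge
  have hl' := H.pairVel_add_two_add_ge hj ha ha'
  have hzq := H.zeta_pos j
  have hzw := H.zeta_pos (j + 2)
  have hzx := H.zeta_pos (j + 1)
  have hzqw := H.zeta_lt h6
  have hzpx := H.zeta_lt h3
  have hzxq := H.zeta_lt h4
  simp only [add_assoc, Nat.reduceAdd] at hzw hzx
  -- The loss telescopes in the numerators ζ_j. The denominators ζ_(j+1) decrease along even j, so
  -- passing to ζ_(j+3) only weakens the bound.
  have hratio : zeta α t (e (j + 2)) / zeta α t (e (j + 1)) ≤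
      zeta α t (e (j + 2)) / zeta α t (e (j + 3)) :=
    div_le_div_of_nonneg_left hzx.le hzw hzqw.le
  have hratio' : zeta α t (e j) / zeta α t (e (j + 1)) ≤
      zeta α t (e (j + 2)) / zeta α t (e (j + 1)) := by gcongr
  have hr1 := mul_le_mul_of_nonneg_left hratio hτ.le
  have hr2 := mul_le_mul_of_nonneg_left hratio' hτ.le
  obtain ⟨k1, k2⟩ := H.defect_bounds hj
  set E2 := logDefect α (o j) (o (j + 2)) with hE2
  have a2 : 0 ≤ E2 := logDefect_nonneg hα (H.o_pos _).le (H.o_pos _).le (H.o_lt h3).ne'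
  have b2 : E2 ≤ α - 1 := logDefect_le hα (H.o_pos _).le (H.o_pos _).le (H.o_lt h3).ne'
  have hloss := H.loss_le hj ha hB (mul_nonneg a2 (sub_nonneg.2 hzpx.le))
  have hloss2 : E2 * (zeta α t (e (j + 2)) - zeta α t (e j)) / ((α - 1) * zeta α t (e (j + 1))) ≤
      zeta α t (e (j + 2)) / zeta α t (e (j + 1)) - zeta α t (e j) / zeta α t (e (j + 1)) := by
    rw [← sub_div, div_le_div_iff₀ (mul_pos (by linarith) hzq) hzq]
    have := mul_le_mul_of_nonneg_right b2
      (mul_nonneg (sub_nonneg.2 hzpx.le) hzq.le)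
    linarith
  have hloss3 := mul_le_mul_of_nonneg_left hloss2 hτ.le
  have v1 := H.le_vel_add_mul hj ha k1 k2 hb.vel_ge hb.pair_ge
  have v2 := H.le_vel_add_add_mul hj ha (m := l 1 -
    (2 - t) / 2 * (zeta α t (e j) / zeta α t (e (j + 1)))) k1 k2 hb.vel_add_ge (by
      have := hb.pair_add_ge
      have : 0 ≤ (2 - t) / 2 * (zeta α t (e j) / zeta α t (e (j + 1))) :=
        mul_nonneg hτ.le (div_nonneg (H.zeta_nonneg j) hzq.le)
      linarith)
  have hpairpos : 0 < pairVel e l (j + 2) := by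
    have := H.pairVel_add_two_ge hj ha ha' hma hmB
    linarith
  have hx1 : zeta α t (e (j + 2)) / zeta α t (e (j + 1)) ≤ 1 := by
    rw [div_le_one hzq]; exact hzxq.le
  have hx2 := mul_le_mul_of_nonneg_left hx1 hτ.le
  set K := logDefect α (e j) (e (j + 2)) - α * zeta α t (e j) * E2 with hK
  have main := H.vel_add_two_ge hj ha hB hpairpos (by linarith)
    (m := vel e l j + K * (l (j + 2) - l j) - (2 - t) / 2 * (zeta α t (e (j + 2)) /
      zeta α t (e (j + 1)) - zeta α t (e j) / zeta α t (e (j + 1))))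
    (by linarith) (by linarith)
  refine ⟨?_, ?_, ?_, ?_⟩
  · simp only [add_assoc, Nat.reduceAdd]; linarith
  · simp only [add_assoc, Nat.reduceAdd]; linarith
  · simp only [add_assoc, Nat.reduceAdd]; linarith
  · linarith [hb.pair_add_ge]

lemma bounds_of_even (H : LogVelocity α t e o l L) (hM : 2 - t < vel e l 0) {j : ℕ}
    (hj : Even j) : Bounds α t e l j := by
  obtain ⟨m, rfl⟩ := hj
  induction m with
  | zero => exact H.bounds_zero
  | succ m ih =>
    rw [show m + 1 + (m + 1) = m + m + 2 by ring]
    exact H.bounds_add_two ⟨m, rfl⟩ hM ih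

end LogVelocity

/-! ### Odd indices of the odd family, by backward comparison -/

lemma log_le_sub_inv_div_two {R : ℝ} (hR : 1 ≤ R) : Real.log R ≤ (R - R⁻¹) / 2 := by
  have h := Real.self_le_sinh_iff.2 (Real.log_nonneg hR)
  rwa [Real.sinh_log (by linarith)] at h

lemma two_mul_sub_one_div_le_log {R : ℝ} (hR : 1 ≤ R) : 2 * (R - 1) / (R + 1) ≤ Real.log R := by
  have h := Real.le_log_one_add_of_nonneg (sub_nonneg.2 hR)
  rw [add_sub_cancel] at h
  convert h using 2
  ring

lemma log_div_eq_mul_log_div {α c u v : ℝ} (hc : 0 < c) (hu : 0 < u) (hv : 0 < v) :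
    Real.log (c * v ^ α / (c * u ^ α)) = α * Real.log (v / u) := by
  rw [mul_div_mul_left _ _ hc.ne', ← Real.div_rpow hv.le hu.le, Real.log_rpow (by positivity)]

/-- With R = (v/u)^α, the bound log R ≤ (R - 1/R)/2 is played against log(v/u) ≥ 1 - u/v. -/
lemma mul_sub_mul_two_mul_le {α c u v : ℝ} (hα : 0 < α) (hc : 0 < c) (hu : 0 < u) (huv : u ≤ v) :
    α * (v - u) * (2 * (c * u ^ α) * (c * v ^ α)) ≤
      v * ((c * v ^ α) ^ 2 - (c * u ^ α) ^ 2) := by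
  have hv : 0 < v := by linarith
  have hlog := log_div_eq_mul_log_div (α := α) hc hu hv
  have hle : u ^ α ≤ v ^ α := by gcongr
  set U := c * u ^ α with hU
  set V := c * v ^ α with hV
  have hU0 : 0 < U := by positivity
  have hV0 : 0 < V := by positivity
  have hUV : U ≤ V := by rw [hU, hV]; gcongr
  have h1 := log_le_sub_inv_div_two ((one_le_div hU0).2 hUV)
  have h2 := Real.one_sub_inv_le_log_of_pos (div_pos hv hu)
  rw [hlog] at h1
  have h3 : α * (1 - (v / u)⁻¹) ≤ (V / U - (V / U)⁻¹) / 2 :=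
    (mul_le_mul_of_nonneg_left h2 hα.le).trans h1
  have e1 : α * (1 - (v / u)⁻¹) = α * (v - u) / v := by field_simp
  have e2 : (V / U - (V / U)⁻¹) / 2 = (V ^ 2 - U ^ 2) / (2 * U * V) := by
    field_simp
  rw [e1, e2, div_le_div_iff₀ hv (by positivity)] at h3
  linarith

/-- With R = (v/u)^α, the bound log R ≥ 2(R-1)/(R+1) is played against log(v/u) ≤ v/u - 1. -/
lemma two_mul_sub_mul_le {α c u v : ℝ} (hα : 0 < α) (hc : 0 < c) (hu : 0 < u) (huv : u ≤ v) :
    2 * (c * v ^ α - c * u ^ α) * u ≤ α * (v - u) * (c * v ^ α + c * u ^ α) := by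
  have hv : 0 < v := by linarith
  have hlog := log_div_eq_mul_log_div (α := α) hc hu hv
  have hle : u ^ α ≤ v ^ α := by gcongr
  set U := c * u ^ α with hU
  set V := c * v ^ α with hV
  have hU0 : 0 < U := by positivity
  have hV0 : 0 < V := by positivity
  have hUV : U ≤ V := by rw [hU, hV]; gcongr
  have h1 := two_mul_sub_one_div_le_log ((one_le_div hU0).2 hUV)
  have h2 := Real.log_le_sub_one_of_pos (div_pos hv hu)
  rw [hlog] at h1
  have h3 : 2 * (V / U - 1) / (V / U + 1) ≤ α * (v / u - 1) :=
    h1.trans (mul_le_mul_of_nonneg_left h2 hα.le)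
  have e1 : α * (v / u - 1) = α * (v - u) / u := by field_simp
  have e2 : 2 * (V / U - 1) / (V / U + 1) = 2 * (V - U) / (V + U) := by
    field_simp
  rw [e1, e2, div_le_div_iff₀ (by positivity) hu] at h3
  linarith

lemma div_sub_le_backward {P Q X a r t τ : ℝ} (hP : 1 ≤ P) (hPX : P < X) (hXQ : X < Q)
    (hQ : Q ≤ t) (hτ : 0 ≤ τ) (hr : r ≤ 1) (ha : 0 < a) :
    a / t - τ ≤ 2 * X * a / (Q + X) -
      (P * Q * τ + (P - 1) * a * (P * r + Q) - P * (Q - X) * a) / (P * (Q + X)) := by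
  have hX : 0 < X := by linarith
  have hQ0 : 0 < Q := by linarith
  have hP0 : 0 < P := by linarith
  have h6 : a / t ≤ a / P := div_le_div_of_nonneg_left ha.le hP0 (by linarith)
  have e3 : 2 * X * a / (Q + X) -
      (P * Q * τ + (P - 1) * a * (P * r + Q) - P * (Q - X) * a) / (P * (Q + X)) =
      (a * (P * (Q + X) - (P - 1) * (P * r + Q)) - P * Q * τ) / (P * (Q + X)) := by
    field_simp
    ring
  have e4 : (a / P - τ) * (P * (Q + X)) = a * (Q + X) - τ * (P * (Q + X)) := by
    field_simp
  have h8 : P * r ≤ P * 1 := mul_le_mul_of_nonneg_left hr hP0.le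
  have h9 : 0 ≤ a * ((P - 1) * (X - P * r)) :=
    mul_nonneg ha.le (mul_nonneg (by linarith) (by linarith))
  have h10 : 0 ≤ τ * (P * X) := by positivity
  rw [e3]
  refine le_trans (sub_le_sub_right h6 τ) ?_
  rw [le_div_iff₀ (by positivity), e4]
  linarith

/-- Comparison of the velocities before and after the map `u ↦ c * u ^ α`. -/
lemma backward_bound {P Q X A C c₀ c₁ a r t τ J : ℝ} (hP : 1 ≤ P) (hPX : P < X) (hXQ : X < Q)
    (hQ : Q ≤ t) (hτ : 0 ≤ τ) (hr0 : r * (Q - P) = Q - X) (ha : 0 < a)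
    (hA : 0 ≤ A)
    (hc₁ : 2 * X * Q / (Q ^ 2 - X ^ 2) ≤ c₁) (hc₀ : c₀ ≤ (X + P) / (2 * (X - P)))
    (hc₀' : P / (X - P) ≤ c₀) (ha_eq : a = Q * A / (Q - X) - P * C / (X - P))
    (hC : C = (X - P) * (J - P * r * a) / (X * P))
    (hJ : (Q - P) * J ≤ P * Q * τ + (P - 1) * a * (P * r + Q)) :
    a / t - τ ≤ c₁ * A - c₀ * C := by
  have hX : 0 < X := by linarith
  have hQ0 : 0 < Q := by linarith
  have hP0 : 0 < P := by linarith
  have hXP : 0 < X - P := by linarith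
  have hQX : 0 < Q - X := by linarith
  have hQP : 0 < Q - P := by linarith
  have ht : 0 < t := by linarith
  have hr : r ≤ 1 := by
    by_contra! h
    nlinarith
  have hA1 : 2 * X / (Q + X) * (Q * A / (Q - X)) ≤ c₁ * A := by
    have h := mul_le_mul_of_nonneg_right hc₁ hA
    have hs : Q ^ 2 - X ^ 2 = (Q - X) * (Q + X) := by ring
    rw [hs] at h
    refine le_trans (le_of_eq ?_) h
    field_simp
  have hQA : Q * A / (Q - X) = a + P * C / (X - P) := by linarith
  -- The sign of C decides whether the lower or the upper bound on c₀ is the useful one.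
  rcases le_or_gt C 0 with hC0 | hC0
  · have h1 : c₀ * C ≤ P / (X - P) * C := mul_le_mul_of_nonpos_right hc₀' hC0
    have h2 : 2 * X / (Q + X) ≤ 1 := by rw [div_le_one (by linarith)]; linarith
    have h3 : P / (X - P) * C ≤ 0 := mul_nonpos_of_nonneg_of_nonpos (by positivity) hC0
    have h4 : a / t ≤ 2 * X / (Q + X) * a := by
      rw [div_eq_inv_mul]
      refine mul_le_mul_of_nonneg_right ?_ ha.le
      rw [inv_eq_one_div, div_le_div_iff₀ ht (by linarith)]
      nlinarith
    have h5 : P * C / (X - P) = P / (X - P) * C := by ring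
    rw [hQA, h5] at hA1
    nlinarith
  · have h1 : c₀ * C ≤ (X + P) / (2 * (X - P)) * C := mul_le_mul_of_nonneg_right hc₀ hC0.le
    have hJ0 : 0 < J - P * r * a := by
      by_contra! h
      have : C ≤ 0 := by
        rw [hC]
        exact div_nonpos_of_nonpos_of_nonneg (mul_nonpos_of_nonneg_of_nonpos hXP.le h)
          (by positivity)
      linarith
    rw [hQA] at hA1
    have e1 : 2 * X / (Q + X) * (a + P * C / (X - P)) - (X + P) / (2 * (X - P)) * C =
        2 * X * a / (Q + X) -
          ((X + P) * (Q + X) - 4 * X * P) * (J - P * r * a) / (2 * X * P * (Q + X)) := by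
      rw [hC]
      field_simp
      ring
    have h2 : ((X + P) * (Q + X) - 4 * X * P) * (J - P * r * a) ≤
        2 * (Q - P) * X * (J - P * r * a) := by
      refine mul_le_mul_of_nonneg_right ?_ hJ0.le
      nlinarith [mul_pos hQX hXP]
    have h3 : ((X + P) * (Q + X) - 4 * X * P) * (J - P * r * a) / (2 * X * P * (Q + X)) ≤
        2 * (Q - P) * X * (J - P * r * a) / (2 * X * P * (Q + X)) := by gcongr
    have e2 : 2 * (Q - P) * X * (J - P * r * a) / (2 * X * P * (Q + X)) =
        ((Q - P) * J - P * (r * (Q - P)) * a) / (P * (Q + X)) := by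
      field_simp
    have h4 : ((Q - P) * J - P * (r * (Q - P)) * a) / (P * (Q + X)) ≤
        (P * Q * τ + (P - 1) * a * (P * r + Q) - P * (Q - X) * a) / (P * (Q + X)) := by
      rw [hr0]
      gcongr
    have h5 := div_sub_le_backward hP hPX hXQ hQ hτ hr ha
    linarith

namespace LogVelocity

variable {α t : ℝ} {e o l L : ℕ → ℝ}

set_option maxHeartbeats 1000000 in
-- The points o_(j+1), o_(j+2), o_(j+3) are sent by u ↦ t·u^α to P, Q, X = 1 + e_(j+2), 1 + e_(j+3),
-- 1 + e_(j+4). The velocity of their images is already known, and `backward_bound` undoes the power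
-- map.
lemma vel_odd_succ_ge (H : LogVelocity α t e o l L) {j : ℕ} (hj : Even j)
    (hM : 2 - t < vel e l 0) : vel e l (j + 2) / t - (2 - t) / 2 ≤ vel o L (j + 1) := by
  have hα := H.one_lt_exp
  have ht := H.one_lt
  have ht0 : 0 < t := by linarith
  have hτ : 0 ≤ (2 - t) / 2 := by linarith [H.lt_two]
  have hj2 : Even (j + 2) := hj.add even_two
  have hb := H.bounds_of_even hM hj2
  obtain ⟨ha, hB, hal, hBl, -, -⟩ := hb.pos H hj2 hM
  obtain ⟨h3, h4⟩ := H.lt_of_even hj2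
  have hA := H.mul_L_sub_succ hj2
  have hZ := H.l_sub_eq hj2
  have htan := H.tangent (j + 2) (j + 3)
  simp only [add_assoc, Nat.reduceAdd] at h3 h4 hA hZ htan
  have hp : 0 < e (j + 2) := H.e_succ_pos _
  have hE0 : 1 + e (j + 2) = t * o (j + 1) ^ α := by
    have := H.e_succ (j + 1)
    simp only [add_assoc, Nat.reduceAdd] at this
    rw [this]; ring
  have hE1 : 1 + e (j + 3) = t * o (j + 2) ^ α := by
    have := H.e_succ (j + 2)
    simp only [add_assoc, Nat.reduceAdd] at this
    rw [this]; ring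
  have hE2 : 1 + e (j + 4) = t * o (j + 3) ^ α := by
    have := H.e_succ (j + 3)
    simp only [add_assoc, Nat.reduceAdd] at this
    rw [this]; ring
  have y0 := H.o_pos (j + 1)
  have y1 := H.o_pos (j + 2)
  have y2 := H.o_pos (j + 3)
  obtain ⟨g1, g2⟩ := H.lt_of_even' hj
  have hy21 : o (j + 3) < o (j + 2) := H.o_lt g1
  have hy02 : o (j + 1) < o (j + 3) := H.o_lt g2
  have m0 := H.mul_L (j + 1)
  have m1 := H.mul_L (j + 2)
  have m2 := H.mul_L (j + 3)
  simp only [add_assoc, Nat.reduceAdd] at m0 m1 m2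
  have b1 := mul_sub_mul_two_mul_le (by linarith : 0 < α) ht0 y2 hy21.le
  have b2 := two_mul_sub_mul_le (by linarith : 0 < α) ht0 y0 hy02.le
  have b3 : α * (o (j + 3) - o (j + 1)) * (t * o (j + 1) ^ α) ≤
      o (j + 1) * (t * o (j + 3) ^ α - t * o (j + 1) ^ α) := by
    have := mul_le_mul_of_nonneg_left (mul_rpow_sub_le hα.le y0.le y2.le) ht0.le
    linarith
  rw [← hE1, ← hE2] at b1
  rw [← hE0, ← hE2] at b2 b3
  set p := e (j + 2) with hpdef
  set q := e (j + 3) with hqdef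
  set x := e (j + 4) with hxdef
  set a := vel e l (j + 2) with hadef
  set B := pairVel e l (j + 2) with hBdef
  have hq0 : 0 < 1 + q := by linarith
  have hx0 : 0 < 1 + x := by linarith
  have hp0 : 0 < 1 + p := by linarith
  have hα0 : 0 < α := by linarith
  have hy : vel o L (j + 1) = o (j + 2) / (α * (o (j + 2) - o (j + 3))) *
      (α * (L (j + 2) - L (j + 3))) - o (j + 1) / (α * (o (j + 3) - o (j + 1))) *
      (α * (L (j + 3) - L (j + 1))) := by
    unfold vel crossVel
    simp only [add_assoc, Nat.reduceAdd]
    have : 0 < o (j + 2) - o (j + 3) := by linarith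
    have : 0 < o (j + 3) - o (j + 1) := by linarith
    field_simp
  rw [hy]
  have hqp : 0 < q - p := by linarith
  have hxp : 0 < x - p := by linarith
  have hqx : 0 < q - x := by linarith
  have hqp1 : 1 + q - (1 + p) = q - p := by ring
  have hxp1 : 1 + x - (1 + p) = x - p := by ring
  have hqx1 : 1 + q - (1 + x) = q - x := by ring
  refine backward_bound (P := 1 + p) (Q := 1 + q) (X := 1 + x) (r := (q - x) / (q - p))
    (J := (1 + p) * (B + l (j + 2)) - p * l (j + 2)) (by linarith) (by linarith)
    (by linarith) (by linarith [H.e_le (j + 3)]) hτ ?_ ha ?_ ?_ ?_ ?_ ?_ ?_ ?_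
  · rw [hqp1, hqx1]; field_simp
  · rw [hA]
    refine div_nonneg (mul_nonneg hqx.le ?_) (by positivity)
    have := mul_pos hp hB
    have : 0 ≤ (1 + q) * ((x - p) / (q - p)) * a := by positivity
    linarith
  · have hsq : 0 < (1 + q) ^ 2 - (1 + x) ^ 2 := by
      have := mul_pos hqx (add_pos hq0 hx0)
      linarith
    rw [div_le_div_iff₀ hsq (mul_pos hα0 (by linarith))]
    linarith
  · rw [div_le_div_iff₀ (mul_pos hα0 (by linarith)) (by linarith)]
    linarith
  · rw [div_le_div_iff₀ (by linarith) (mul_pos hα0 (by linarith))]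
    linarith
  · rw [hqx1, hxp1, mul_sub α, mul_sub α, m0, m1, m2, hadef]
    unfold vel crossVel
    simp only [add_assoc, Nat.reduceAdd, ← hpdef, ← hqdef, ← hxdef]
    field_simp
    ring
  · rw [hxp1, mul_sub α, m0, m2]
    have hl : l (j + 4) = l (j + 2) + (1 - p / x) * (B - (q - x) / (q - p) * a) := by
      linarith [hZ.1]
    have hxx : 0 < x := by linarith
    rw [hl]
    field_simp
    ring
  · rw [hqp1]
    have hz := H.zeta_nonneg (j + 2)
    rw [← hpdef] at hz
    have hBq : (q - p) * B = q * (l (j + 3) - l (j + 2)) := by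
      rw [hBdef]; unfold pairVel
      simp only [add_assoc, Nat.reduceAdd, ← hpdef, ← hqdef]
      field_simp
    have hvq : q * l (j + 3) = (1 + q) * ((2 - t) / 2 - α * zeta α t p *
        (α * l (j + 2) + (2 - t) / 2)) := by
      have h := H.l_succ (j + 2)
      rw [H.L_eq] at h
      simp only [add_assoc, Nat.reduceAdd, ← hpdef, ← hqdef] at h
      rw [h]; ring
    have e1 : (q - p) * ((1 + p) * (B + l (j + 2)) - p * l (j + 2)) =
        (1 + q) * ((1 + p) * ((2 - t) / 2 - α * zeta α t p *
        (α * l (j + 2) + (2 - t) / 2)) - p * l (j + 2)) := by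
      have : (q - p) * ((1 + p) * (B + l (j + 2)) - p * l (j + 2)) =
        (1 + p) * ((q - p) * B) + (q - p) * l (j + 2) := by ring
      rw [this, hBq]
      have : (1 + p) * (q * (l (j + 3) - l (j + 2))) + (q - p) * l (j + 2) =
        (1 + p) * (q * l (j + 3)) - (1 + q) * (p * l (j + 2)) := by ring
      rw [this, hvq]; ring
    rw [e1]
    have htan' : α ^ 2 * zeta α t p * (1 + q) ≤ p * ((q - x) / (q - p)) := by
      rw [← mul_div_assoc, le_div_iff₀ hqp]
      exact htan
    set z := zeta α t p
    -- Here the invariant `vel_add_ge` is needed: it yields positivity of a + l_(j+2).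
    have hneg : -l (j + 2) ≤ a := by linarith
    have k1 : (1 + q) * (1 + p) * (-(α * z * (α * l (j + 2) + (2 - t) / 2))) ≤
        (1 + p) * (p * ((q - x) / (q - p)) * a) := by
      have k2 : -(α * z * (α * l (j + 2) + (2 - t) / 2)) ≤ α ^ 2 * z * a := by
        have k3 : 0 ≤ α ^ 2 * z * (a + l (j + 2)) := by positivity
        have k4 : 0 ≤ α * z * ((2 - t) / 2) := by positivity
        nlinarith
      have k5 := mul_le_mul_of_nonneg_left k2 (by positivity : 0 ≤ (1 + q) * (1 + p))
      have k6 := mul_le_mul_of_nonneg_left htan' (by positivity : 0 ≤ (1 + p) * a)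
      linarith
    have k7 : (1 + q) * p * (-l (j + 2)) ≤ (1 + q) * p * a :=
      mul_le_mul_of_nonneg_left hneg (by positivity)
    linarith

/-- All velocities of Poincaré coordinates exceed `1` as soon as the first one is large. -/
theorem one_lt_vel (H : LogVelocity α t e o l L)
    (hM : 2 + (t - 1) * (2 - t) / 2 < vel e l 0) (j : ℕ) : 1 < vel e l j ∧ 1 < vel o L j := by
  have ht := H.one_lt
  have ht2 := H.lt_two
  have hM' : 2 - t < vel e l 0 := by nlinarith
  have key : ∀ i, Even i → (vel e l 0 - (2 - t) / 2 ≤ vel e l i ∧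
      vel e l 0 - (2 - t) / 2 ≤ vel o L i) ∧ vel e l 0 - (2 - t) ≤ vel e l (i + 1) := by
    intro i hi
    have hb := H.bounds_of_even hM' hi
    obtain ⟨ha, hB, -, -, h1, h2⟩ := hb.pos H hi hM'
    refine ⟨⟨h1, H.vel_odd_ge hi ha hB h1 h2⟩, ?_⟩
    have := H.vel_even_succ_ge hi ha hB h1 h2
    linarith
  rcases Nat.even_or_odd j with h | ⟨m, rfl⟩
  · have := (key j h).1
    constructor <;> nlinarith
  · constructor
    · have := (key _ (even_two_mul m)).2
      nlinarith
    · have h1 := H.vel_odd_succ_ge (even_two_mul m) hM'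
      have h2 := (key _ ((even_two_mul m).add even_two)).1.1
      have h3 : 1 + (2 - t) / 2 < vel e l (2 * m + 2) / t := by
        rw [lt_div_iff₀ (by linarith)]
        nlinarith
      linarith

end LogVelocity

/-! ### The initial velocity -/

/-- The right side is minimal at s = log(c(1+b)), with value 1 + log(c(1+b)). As c ≥ 1 + b, this is
at least 1 + 2 log(1+b) ≥ 1 + 4b/(b+2), which exceeds c. -/
lemma add_mul_exp_neg_gt {b s c : ℝ} (hb0 : 0 < b) (hb1 : b < 1) (hc : c = 1 + b + b * (1 - b) / 2) :
    c < s + c * ((1 + b) * Real.exp (-s)) := by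
  have hcb : 1 + b ≤ c := by
    rw [hc]; nlinarith
  have hc0 : 0 < c := by linarith
  have hA : 0 < c * (1 + b) := by positivity
  have h1 := Real.add_one_le_exp (Real.log (c * (1 + b)) - s)
  rw [sub_eq_add_neg, Real.exp_add, Real.exp_log hA] at h1
  have h2 : 2 * Real.log (1 + b) ≤ Real.log (c * (1 + b)) := by
    rw [Real.log_mul hc0.ne' (by linarith)]
    have := Real.log_le_log (by linarith) hcb
    linarith
  have h3 := Real.le_log_one_add_of_nonneg hb0.le
  have h4 : b * (3 - b) / 4 < 2 * b / (b + 2) := by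
    rw [div_lt_div_iff₀ (by norm_num) (by linarith)]
    nlinarith
  linarith

/-- With `s = (α - 1) * log (1 / b)` and `ω = α * (1 + b) * b ^ (α - 1)`. -/
lemma base_main_term {α b ω : ℝ} (hα : 1 < α) (hb0 : 0 < b) (hb1 : b < 1)
    (hω : b * ω = α * ((1 + b) * b ^ α)) (hω1 : ω < 1) :
    1 + b + b * (1 - b) / 2 < (α - 1) * (1 - b ^ 2) / (2 * b * (1 - ω)) := by
  set c := 1 + b + b * (1 - b) / 2 with hc
  have hc0 : 0 < c := by rw [hc]; nlinarith
  have h1 := add_mul_exp_neg_gt (s := (α - 1) * (-Real.log b)) hb0 hb1 hc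
  have h2 : Real.exp (-((α - 1) * (-Real.log b))) = b ^ α / b := by
    rw [← Real.rpow_sub_one hb0.ne', Real.rpow_def_of_pos hb0]
    congr 1; ring
  rw [h2] at h1
  have h3 : ω = α * ((1 + b) * (b ^ α / b)) := by
    field_simp; linarith
  have h4 : (1 + b) * (b ^ α / b) ≤ ω := by
    rw [h3]
    have : 0 ≤ (1 + b) * (b ^ α / b) := by positivity
    nlinarith
  have h5 := mul_le_mul_of_nonneg_left h4 hc0.le
  have h6 := log_le_sub_inv_div_two (R := b⁻¹) ((one_le_inv₀ hb0).2 hb1.le)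
  rw [Real.log_inv, inv_inv] at h6
  have h7 : (b⁻¹ - b) / 2 = (1 - b ^ 2) / (2 * b) := by field_simp
  rw [h7] at h6
  have h8 := mul_le_mul_of_nonneg_left h6 (by linarith : 0 ≤ α - 1)
  have h9 : c * (1 - ω) < (α - 1) * ((1 - b ^ 2) / (2 * b)) := by linarith
  have e1 : (α - 1) * (1 - b ^ 2) / (2 * b * (1 - ω)) =
      (α - 1) * ((1 - b ^ 2) / (2 * b)) / (1 - ω) := by
    have : 1 - ω ≠ 0 := by linarith
    field_simp
  rw [e1, lt_div_iff₀ (by linarith)]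
  exact h9

/-- Lower bound for the initial velocity, in terms of `m = y ^ (-α) - 1`, `y = 1 - (1 + b) * b ^ α`. -/
lemma base_bound {α b m S : ℝ} (hα : 1 < α) (hb0 : 0 < b) (hb1 : b < 1)
    (hm : α * ((1 + b) * b ^ α) ≤ m) (hmb : m < b) (hS : 2 / (2 + m) ≤ S) :
    2 + b * (1 - b) / 2 <
      (1 - b) / 2 * (1 + m) / (b - m) * (S * (b + α * (1 + b)) - 1) := by
  have hpos : 0 < α * ((1 + b) * b ^ α) := by positivity
  have hm0 : 0 < m := by linarith
  set ω := α * ((1 + b) * b ^ α) / b with hω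
  have hbω : b * ω = α * ((1 + b) * b ^ α) := by rw [hω]; field_simp
  have hω0 : 0 < ω := by positivity
  have hω1 : ω < 1 := by
    rw [hω, div_lt_one hb0]; linarith
  have hmain := base_main_term hα hb0 hb1 hbω hω1
  have hbm : 0 < b - m := by linarith
  have hbm' : b - m ≤ b * (1 - ω) := by linarith
  have hN : 0 < 2 * (α - 1) * (1 + b) + 3 * b := by
    have : 0 < (α - 1) * (1 + b) := mul_pos (by linarith) (by linarith)
    linarith
  have h1 : 2 / (2 + m) * (b + α * (1 + b)) - 1 ≤ S * (b + α * (1 + b)) - 1 := by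
    have : 0 ≤ b + α * (1 + b) := by positivity
    have := mul_le_mul_of_nonneg_right hS this
    linarith
  have hcoef : 0 ≤ (1 - b) / 2 * (1 + m) / (b - m) :=
    div_nonneg (mul_nonneg (by linarith) (by linarith)) hbm.le
  have h2 := mul_le_mul_of_nonneg_left h1 hcoef
  have e2 : (1 - b) / 2 * (1 + m) / (b - m) * (2 / (2 + m) * (b + α * (1 + b)) - 1) =
      (1 - b) / 2 * ((1 + m) / (2 + m)) *
        ((2 * (α - 1) * (1 + b) + 3 * b) / (b - m) + 1) := by
    have : 2 + m ≠ 0 := by linarith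
    field_simp
    ring
  have h3 : 1 / 2 ≤ (1 + m) / (2 + m) := by
    rw [div_le_div_iff₀ (by norm_num) (by linarith)]; linarith
  have h4 : (2 * (α - 1) * (1 + b) + 3 * b) / (b * (1 - ω)) ≤
      (2 * (α - 1) * (1 + b) + 3 * b) / (b - m) :=
    div_le_div_of_nonneg_left hN.le hbm hbm'
  have h5 : 2 * (α - 1) * (1 + b) / (b * (1 - ω)) + 3 ≤
      (2 * (α - 1) * (1 + b) + 3 * b) / (b * (1 - ω)) := by
    have hp : 0 < b * (1 - ω) := mul_pos hb0 (by linarith)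
    rw [div_add' _ _ _ hp.ne']
    gcongr
    nlinarith
  have h6 : (1 - b) / 2 * (1 / 2) * (2 * (α - 1) * (1 + b) / (b * (1 - ω)) + 3 + 1) ≤
      (1 - b) / 2 * ((1 + m) / (2 + m)) *
        ((2 * (α - 1) * (1 + b) + 3 * b) / (b - m) + 1) := by
    have : 0 ≤ 2 * (α - 1) * (1 + b) / (b * (1 - ω)) :=
      div_nonneg (mul_nonneg (by linarith) (by linarith)) (mul_nonneg hb0.le (by linarith))
    have hb2 : 0 ≤ (1 - b) / 2 := by linarith
    gcongr
    linarith
  have e3 : (1 - b) / 2 * (1 / 2) * (2 * (α - 1) * (1 + b) / (b * (1 - ω)) + 3 + 1) =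
      (α - 1) * (1 - b ^ 2) / (2 * b * (1 - ω)) + (1 - b) := by
    have : 1 - ω ≠ 0 := by linarith
    field_simp
    ring
  rw [e2] at h2
  linarith

namespace LogVelocity

variable {α t : ℝ} {e o l L : ℕ → ℝ}

lemma vel_zero_eq (H : LogVelocity α t e o l L) : vel e l 0 = (2 - t) / 2 / (t * o 1 ^ α - 1) *
    (α * (t * (t - 1) ^ α) * (o 1 ^ α / o 1) / (1 - o 1 ^ α) * (t - 1 + α * t) - 1) := by
  have ht := H.one_lt
  have hα := H.one_lt_exp
  have he2 : e 2 = t * o 1 ^ α - 1 := H.e_succ 1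
  have he20 : 0 < e 2 := H.e_succ_pos 1
  have hl1 : l 1 = t * ((2 - t) / 2) / (t - 1) := by
    rw [eq_div_iff (by linarith)]; linarith [H.l_one]
  have hl2 := H.l_succ 1
  have hL := H.L_eq 1
  have hy := H.o_pos 1
  have hd : t * (t - 1) ^ α = 1 - o 1 := by rw [H.o_eq, H.e_one]; ring
  rw [H.zeta_eq, H.e_one, hd, hl1] at hL
  rw [hL] at hl2
  have hl2' : l 2 = (1 + e 2) * ((2 - t) / 2 + α * -((1 - o 1) / o 1 *
      (α * (t * ((2 - t) / 2) / (t - 1)) + (2 - t) / 2))) / e 2 := by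
    rw [eq_div_iff he20.ne', ← hl2]; ring
  have hne : 1 - o 1 ^ α ≠ 0 := by
    have h1 : o 1 < o 0 := H.o_lt (by rw [H.e_zero]; exact H.e_succ_pos 0)
    rw [H.o_zero] at h1
    have := Real.rpow_lt_one hy.le h1 (by linarith : 0 < α)
    linarith
  have h12 : e 1 - e 2 = t * (1 - o 1 ^ α) := by rw [H.e_one, he2]; ring
  have hv : vel e l 0 = e 1 * (l 1 - l 2) / (e 1 - e 2) := by
    unfold vel crossVel
    rw [H.e_zero]; simp
  rw [hv, h12, H.e_one, hd, hl2', hl1, he2]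
  rw [he2] at he20
  have n1 : t - 1 ≠ 0 := by linarith
  have n2 := he20.ne'
  field_simp
  ring

/-- The initial velocity is large enough to start the induction. -/
theorem vel_zero_gt (H : LogVelocity α t e o l L) :
    2 + (t - 1) * (2 - t) / 2 < vel e l 0 := by
  have ht := H.one_lt
  have ht2 := H.lt_two
  have hα := H.one_lt_exp
  have hy := H.o_pos 1
  have hd : t * (t - 1) ^ α = 1 - o 1 := by rw [H.o_eq, H.e_one]; ring
  have hy1 : o 1 < 1 := by
    have h1 : o 1 < o 0 := H.o_lt (by rw [H.e_zero]; exact H.e_succ_pos 0)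
    rwa [H.o_zero] at h1
  have hY1 := Real.rpow_lt_one hy.le hy1 (by linarith : 0 < α)
  have hY0 : 0 < o 1 ^ α := Real.rpow_pos_of_pos hy α
  have he20 : 0 < e 2 := H.e_succ_pos 1
  rw [show e 2 = t * o 1 ^ α - 1 from H.e_succ 1] at he20
  set y := o 1 with hydef
  -- In terms of b = t - 1, e_2 = (b - m)/(1 + m), so m < b expresses e_2 > 0.
  set m := (1 / y) ^ α - 1 with hm
  have hm' : 1 + m = 1 / y ^ α := by
    rw [hm, Real.div_rpow zero_le_one hy.le, Real.one_rpow]; ring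
  have hYm : y ^ α = 1 / (1 + m) := by rw [hm', one_div_one_div]
  have hm0 : 0 < m := by
    have : 1 < 1 / y ^ α := by rw [lt_div_iff₀ hY0]; linarith
    linarith
  have hmb : m < t - 1 := by
    have : 1 / y ^ α < t := by rw [div_lt_iff₀ hY0]; linarith
    linarith
  have hinv : 1 - y ≤ 1 / y - 1 := by
    rw [div_sub_one hy.ne', le_div_iff₀ hy]; nlinarith
  have hmge : α * ((1 + (t - 1)) * (t - 1) ^ α) ≤ m := by
    have h := one_add_mul_self_le_rpow_one_add (s := 1 / y - 1)
      (by have : 0 < 1 / y := by positivity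
          linarith) hα.le
    rw [add_sub_cancel] at h
    rw [show 1 + (t - 1) = t by ring, hd]
    have := mul_le_mul_of_nonneg_left hinv (by linarith : 0 ≤ α)
    linarith
  have hlog : 2 * m / (m + 2) ≤ α * (1 / y - 1) := by
    have h1 := Real.le_log_one_add_of_nonneg hm0.le
    have h2 : Real.log (1 + m) = α * Real.log (1 / y) := by
      rw [hm, add_sub_cancel, Real.log_rpow (by positivity)]
    have h3 := Real.log_le_sub_one_of_pos (by positivity : 0 < 1 / y)
    have := mul_le_mul_of_nonneg_left h3 (by linarith : 0 ≤ α)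
    linarith
  have hSeq : α * (1 - y) * (y ^ α / y) / (1 - y ^ α) = α * (1 / y - 1) / m := by
    rw [hYm]
    have : 1 + m ≠ 0 := by linarith
    have h2 : 1 - 1 / (1 + m) = m / (1 + m) := by field_simp; ring
    rw [h2]
    field_simp
  have hS : 2 / (2 + m) ≤ α * (1 / y - 1) / m := by
    rw [le_div_iff₀ hm0]
    refine le_trans (le_of_eq ?_) hlog
    rw [add_comm m 2]; ring
  have key := base_bound hα (by linarith) (by linarith) hmge hmb hS
  rw [H.vel_zero_eq, hd, ← hydef, hSeq]
  convert key using 1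
  · ring
  · have e1 : (2 - t) / 2 / (t * y ^ α - 1) = (1 - (t - 1)) / 2 * (1 + m) / (t - 1 - m) := by
      rw [hYm]
      have : 1 + m ≠ 0 := by linarith
      have h3 : t - 1 - m ≠ 0 := by linarith
      have h2 : t * (1 / (1 + m)) - 1 = (t - 1 - m) / (1 + m) := by field_simp; ring
      rw [h2]
      field_simp
      ring
    rw [e1]
    ring

end LogVelocity

/-! ### The interval of admissible parameters -/

/-- `|y (2 j)|` for the critical orbit `y (n + 1) = 1 - t * |y n| ^ α`, when the kneading sequence
is `RLRL…`. -/
def evenAbs (α t : ℝ) : ℕ → ℝ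
  | 0 => 0
  | j + 1 => t * (1 - t * evenAbs α t j ^ α) ^ α - 1

/-- `y (2 j + 1)` for the critical orbit `y (n + 1) = 1 - t * |y n| ^ α`, when the kneading sequence
is `RLRL…`. -/
def oddPt (α t : ℝ) (j : ℕ) : ℝ := 1 - t * evenAbs α t j ^ α

lemma evenAbs_one {α : ℝ} (hα : 1 < α) (t : ℝ) : evenAbs α t 1 = t - 1 := by
  simp [evenAbs, Real.zero_rpow (by linarith : α ≠ 0)]

/-- The parameters `t` whose kneading sequence is `RLRL…`. -/
def Admissible (α t : ℝ) : Prop := CriticalOrbit α t (evenAbs α t) (oddPt α t)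

/-- `t` is admissible iff `1 < t` and `boundaryFun α t < 1`. -/
def boundaryFun (α t : ℝ) : ℝ := (t - 1) ^ (α + 1) + (t - 1) ^ α + t ^ (-(1 / α))

lemma boundaryFun_eq {α t : ℝ} (ht : 1 < t) :
    boundaryFun α t = t * (t - 1) ^ α + t ^ (-(1 / α)) := by
  rw [boundaryFun, Real.rpow_add_one (by linarith)]; ring

lemma rpow_neg_one_div_lt_iff {α t y : ℝ} (hα : 1 < α) (ht : 1 < t) (hy : 0 < y) :
    t ^ (-(1 / α)) < y ↔ 1 < t * y ^ α := by
  have hα0 : 0 < α := by linarith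
  have ht0 : 0 < t := by linarith
  have h : t ^ (-(1 / α)) < y ↔ (t ^ (-(1 / α))) ^ α < y ^ α :=
    (Real.rpow_lt_rpow_iff (by positivity) hy.le hα0).symm
  rw [h, ← Real.rpow_mul ht0.le]
  have e : -(1 / α) * α = -1 := by field_simp
  rw [e, Real.rpow_neg_one, inv_lt_iff_one_lt_mul₀ ht0, mul_comm]

/-- Positivity of o_1 and e_2 suffices: the second iterate is then positive on [0, t-1] and maps it
into itself, and o_j ≥ o_1 throughout. -/
lemma admissible_iff {α t : ℝ} (hα : 1 < α) :
    Admissible α t ↔ 1 < t ∧ boundaryFun α t < 1 := by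
  have hα0 : 0 < α := by linarith
  constructor
  · intro H
    refine ⟨H.one_lt, ?_⟩
    have ht := H.one_lt
    have h1 := H.o_pos 1
    have h2 := H.e_succ_pos 1
    rw [H.e_succ] at h2
    have h3 := (rpow_neg_one_div_lt_iff hα ht h1).2 (by linarith)
    rw [H.o_eq, H.e_one] at h3
    rw [boundaryFun_eq ht]
    linarith
  · rintro ⟨ht, hg⟩
    have ht0 : 0 < t := by linarith
    rw [boundaryFun_eq ht] at hg
    have hpos : 0 < t ^ (-(1 / α)) := by positivity
    have hy : 0 < 1 - t * (t - 1) ^ α := by linarith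
    have h2 := (rpow_neg_one_div_lt_iff hα ht hy).1 (by linarith)
    have hO : ∀ u, 0 ≤ u → u ≤ t - 1 → 1 - t * (t - 1) ^ α ≤ 1 - t * u ^ α := by
      intro u h0 h1
      have : u ^ α ≤ (t - 1) ^ α := by gcongr
      nlinarith
    have hstep : ∀ u, 0 ≤ u → u ≤ t - 1 →
        0 < t * (1 - t * u ^ α) ^ α - 1 ∧ t * (1 - t * u ^ α) ^ α - 1 ≤ t - 1 := by
      intro u h0 h1
      have h3 := hO u h0 h1
      have h4 : (1 - t * (t - 1) ^ α) ^ α ≤ (1 - t * u ^ α) ^ α := by gcongr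
      have h5 : (1 - t * u ^ α) ^ α ≤ 1 := by
        refine Real.rpow_le_one (by linarith) ?_ hα0.le
        have : 0 ≤ t * u ^ α := by positivity
        linarith
      constructor
      · have := mul_le_mul_of_nonneg_left h4 ht0.le
        linarith
      · have := mul_le_mul_of_nonneg_left h5 ht0.le
        linarith
    have hE : ∀ j, 0 ≤ evenAbs α t j ∧ evenAbs α t j ≤ t - 1 := by
      intro j
      induction j with
      | zero => exact ⟨le_rfl, by simp only [evenAbs]; linarith⟩
      | succ j ih => exact ⟨(hstep _ ih.1 ih.2).1.le, (hstep _ ih.1 ih.2).2⟩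
    exact
      { one_lt_exp := hα
        one_lt := ht
        e_zero := rfl
        o_eq := fun _ => rfl
        e_succ := fun _ => rfl
        o_pos := fun j => lt_of_lt_of_le hy (hO _ (hE j).1 (hE j).2)
        e_succ_pos := fun j => (hstep _ (hE j).1 (hE j).2).1 }

lemma hasDerivAt_boundaryFun {α t : ℝ} (hα : 1 < α) (ht : 1 ≤ t) :
    HasDerivAt (boundaryFun α)
      ((α + 1) * (t - 1) ^ α + α * (t - 1) ^ (α - 1) + -(1 / α) * t ^ (-(1 / α) - 1)) t := by
  have hs : HasDerivAt (fun t : ℝ => t - 1) 1 t := (hasDerivAt_id t).sub_const 1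
  have h1 := hs.rpow_const (p := α + 1) (Or.inr (by linarith))
  have h2 := hs.rpow_const (p := α) (Or.inr hα.le)
  have h3 := Real.hasDerivAt_rpow_const (x := t) (p := -(1 / α)) (Or.inl (by linarith))
  have h := (h1.add h2).add h3
  rw [add_sub_cancel_right, one_mul, one_mul] at h
  exact h

lemma convexOn_boundaryFun {α : ℝ} (hα : 1 < α) : ConvexOn ℝ (Set.Ici 1) (boundaryFun α) := by
  have hα0 : 0 < α := by linarith
  refine MonotoneOn.convexOn_of_deriv (convex_Ici 1)
    (fun t ht => (hasDerivAt_boundaryFun hα ht).continuousAt.continuousWithinAt)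
    (fun t ht => (hasDerivAt_boundaryFun hα
      (interior_subset ht)).differentiableAt.differentiableWithinAt) ?_
  intro s hs t ht hst
  rw [interior_Ici] at hs ht
  have hs : 1 < s := hs
  have ht : 1 < t := ht
  rw [(hasDerivAt_boundaryFun hα hs.le).deriv, (hasDerivAt_boundaryFun hα ht.le).deriv]
  have h1 : (s - 1) ^ α ≤ (t - 1) ^ α :=
    Real.rpow_le_rpow (by linarith) (by linarith) hα0.le
  have h2 : (s - 1) ^ (α - 1) ≤ (t - 1) ^ (α - 1) :=
    Real.rpow_le_rpow (by linarith) (by linarith) (by linarith)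
  have hi : 0 < 1 / α := by positivity
  have h3 : t ^ (-(1 / α) - 1) ≤ s ^ (-(1 / α) - 1) :=
    Real.rpow_le_rpow_of_nonpos (by linarith) hst (by linarith)
  have := mul_le_mul_of_nonneg_left h1 (by linarith : 0 ≤ α + 1)
  have := mul_le_mul_of_nonneg_left h2 hα0.le
  have := mul_le_mul_of_nonneg_left h3 hi.le
  linarith

lemma boundaryFun_one {α : ℝ} (hα : 1 < α) : boundaryFun α 1 = 1 := by
  simp [boundaryFun, Real.zero_rpow (by linarith : α ≠ 0), Real.zero_rpow (by linarith : α + 1 ≠ 0)]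

/-- The admissible parameters form an interval `(1, t₁)`. -/
lemma exists_admissible_iff {α : ℝ} (hα : 1 < α) :
    ∃ t₁, 1 < t₁ ∧ t₁ < 2 ∧ ∀ t, Admissible α t ↔ t ∈ Set.Ioo 1 t₁ := by
  have hα0 : 0 < α := by linarith
  have hconv := convexOn_boundaryFun hα
  have h1 := boundaryFun_one hα
  have hcont : ContinuousOn (boundaryFun α) (Set.Icc 1 2) := fun t ht =>
    (hasDerivAt_boundaryFun hα ht.1).continuousAt.continuousWithinAt
  have h2 : 1 < boundaryFun α 2 := by
    have : 0 < (2 : ℝ) ^ (-(1 / α)) := by positivity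
    have e1 : (2 : ℝ) - 1 = 1 := by norm_num
    rw [boundaryFun, e1, Real.one_rpow, Real.one_rpow]
    linarith
  -- At t = 1 the function equals 1 with slope -1/α, so it dips below 1. Convexity then allows only
  -- one return to the level 1.
  obtain ⟨s, hs1, hs⟩ : ∃ s, 1 < s ∧ boundaryFun α s < 1 := by
    have hd := hasDerivAt_boundaryFun hα le_rfl
    have hneg : (α + 1) * ((1 : ℝ) - 1) ^ α + α * ((1 : ℝ) - 1) ^ (α - 1) +
        -(1 / α) * (1 : ℝ) ^ (-(1 / α) - 1) < 0 := by
      rw [sub_self, Real.zero_rpow hα0.ne', Real.zero_rpow (by linarith), Real.one_rpow]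
      have : 0 < 1 / α := by positivity
      linarith
    have hev := hd.tendsto_slope.eventually_lt_const hneg
    have hev' : ∀ᶠ x in nhdsWithin (1 : ℝ) (Set.Ioi 1), slope (boundaryFun α) 1 x < 0 :=
      hev.filter_mono (nhdsWithin_mono _ fun x (hx : 1 < x) => hx.ne')
    obtain ⟨s, h, hs⟩ := (hev'.and self_mem_nhdsWithin).exists
    have hs : 1 < s := hs
    refine ⟨s, hs, ?_⟩
    rw [slope_def_field, h1, div_neg_iff] at h
    rcases h with h | h
    · linarith
    · linarith
  have hs2 : s < 2 := by
    by_contra! hc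
    have := (admissible_iff hα).2 ⟨hs1, hs⟩
    linarith [this.lt_two]
  obtain ⟨t₁, ht₁, hval⟩ : ∃ t₁ ∈ Set.Icc s 2, boundaryFun α t₁ = 1 :=
    intermediate_value_Icc hs2.le (hcont.mono (Set.Icc_subset_Icc_left hs1.le))
      ⟨hs.le, h2.le⟩
  have hst : s < t₁ := lt_of_le_of_ne ht₁.1 (by rintro rfl; linarith)
  have ht2 : t₁ < 2 := lt_of_le_of_ne ht₁.2 (by rintro rfl; linarith)
  refine ⟨t₁, by linarith, ht2, fun t => ?_⟩
  rw [admissible_iff hα]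
  have chord : ∀ x y z, 1 ≤ x → x < y → y < z → (z - x) * boundaryFun α y ≤
      (z - y) * boundaryFun α x + (y - x) * boundaryFun α z := by
    intro x y z hx hxy hyz
    have h := hconv.2 (Set.mem_Ici.2 hx) (Set.mem_Ici.2 (by linarith : 1 ≤ z))
      (div_nonneg (by linarith : 0 ≤ z - y) (by linarith : 0 ≤ z - x))
      (div_nonneg (by linarith : 0 ≤ y - x) (by linarith : 0 ≤ z - x))
      (by rw [← add_div, div_eq_one_iff_eq (by linarith)]; ring)
    simp only [smul_eq_mul] at h
    have hzx : 0 < z - x := by linarith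
    have e1 : (z - y) / (z - x) * x + (y - x) / (z - x) * z = y := by
      field_simp; ring
    rw [e1] at h
    have h' := mul_le_mul_of_nonneg_left h hzx.le
    have e2 : (z - x) * ((z - y) / (z - x) * boundaryFun α x + (y - x) / (z - x) *
      boundaryFun α z) = (z - y) * boundaryFun α x + (y - x) * boundaryFun α z := by
      field_simp
    linarith
  constructor
  · rintro ⟨ht, hg⟩
    refine ⟨ht, ?_⟩
    by_contra! hc
    rcases hc.eq_or_lt with rfl | hc
    · linarith
    have h := chord s t₁ t hs1.le hst hc
    rw [hval] at h
    nlinarith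
  · rintro ⟨ht, htt⟩
    refine ⟨ht, ?_⟩
    rcases lt_trichotomy t s with h | rfl | h
    · have h' := chord 1 t s le_rfl ht h
      rw [h1] at h'
      nlinarith
    · exact hs
    · have h' := chord s t t₁ hs1.le h htt
      rw [hval] at h'
      nlinarith

/-! ### From the family f_a to the rescaled orbit -/

lemma f_neg_mul {α a u : ℝ} (ha : 0 < a) (hu : 0 ≤ u) :
    f α a (-(a * u)) = a * (1 - a ^ (α - 1) * u ^ α) := by
  rw [f, abs_neg, abs_of_nonneg (by positivity), Real.mul_rpow ha.le hu,
    Real.rpow_sub_one ha.ne']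
  field_simp
  ring

lemma f_mul {α a u : ℝ} (ha : 0 < a) (hu : 0 ≤ u) :
    f α a (a * u) = -(a * (a ^ (α - 1) * u ^ α - 1)) := by
  rw [f, abs_of_nonneg (by positivity), Real.mul_rpow ha.le hu, Real.rpow_sub_one ha.ne']
  field_simp
  ring

lemma side_eq_R_iff {x : ℝ} : side x = Side.R ↔ 0 < x := by
  unfold side
  split_ifs with h1 h2
  · simp; linarith
  · simp [h2]
  · simp; exact lt_of_le_of_ne (not_lt.1 h1) (Ne.symm h2)

lemma side_eq_L_iff {x : ℝ} : side x = Side.L ↔ x < 0 := by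
  unfold side
  split_ifs with h1 h2
  · simp [h1]
  · simp [h2]
  · simp; exact not_lt.1 h1

lemma mem_RLRL_iff_sign {α a : ℝ} : a ∈ RLRL α ↔
    ∀ j, 0 < (f α a)^[2 * j + 1] 0 ∧ (f α a)^[2 * j + 2] 0 < 0 := by
  constructor
  · intro h j
    have h1 := h (2 * j)
    have h2 := h (2 * j + 1)
    rw [if_pos (even_two_mul j)] at h1
    rw [if_neg (by simp)] at h2
    exact ⟨side_eq_R_iff.1 h1, side_eq_L_iff.1 h2⟩
  · intro h n
    rcases Nat.even_or_odd' n with ⟨j, rfl | rfl⟩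
    · rw [if_pos (even_two_mul j)]
      exact side_eq_R_iff.2 (h j).1
    · rw [if_neg (by simp)]
      exact side_eq_L_iff.2 (h j).2

/-- The critical orbit in terms of `evenAbs` and `oddPt`, as long as the signs are right. -/
lemma iterate_eq {α a : ℝ} (ha : 0 < a) (j : ℕ)
    (hE : ∀ i ≤ j, 0 ≤ evenAbs α (a ^ (α - 1)) i) (hO : ∀ i < j, 0 ≤ oddPt α (a ^ (α - 1)) i) :
    (f α a)^[2 * j] 0 = -(a * evenAbs α (a ^ (α - 1)) j) ∧
      (f α a)^[2 * j + 1] 0 = a * oddPt α (a ^ (α - 1)) j := by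
  have key : (f α a)^[2 * j] 0 = -(a * evenAbs α (a ^ (α - 1)) j) →
      (f α a)^[2 * j + 1] 0 = a * oddPt α (a ^ (α - 1)) j := fun h => by
    rw [Function.iterate_succ_apply', h, f_neg_mul ha (hE j le_rfl)]; rfl
  induction j with
  | zero =>
    have h0 : (f α a)^[2 * 0] 0 = -(a * evenAbs α (a ^ (α - 1)) 0) := by simp [evenAbs]
    exact ⟨h0, key h0⟩
  | succ j ih =>
    have hprev : (f α a)^[2 * j + 1] 0 = a * oddPt α (a ^ (α - 1)) j := by
      refine (ih (fun i hi => hE i (by omega)) (fun i hi => hO i (by omega)) (fun h => ?_)).2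
      rw [Function.iterate_succ_apply', h, f_neg_mul ha (hE j (by omega))]; rfl
    have h0 : (f α a)^[2 * (j + 1)] 0 = -(a * evenAbs α (a ^ (α - 1)) (j + 1)) := by
      rw [show 2 * (j + 1) = (2 * j + 1) + 1 by ring, Function.iterate_succ_apply', hprev,
        f_mul ha (hO j (by omega))]
      rfl
    exact ⟨h0, key h0⟩

lemma f_zero {α a : ℝ} (hα : 1 < α) : f α a 0 = a := by
  simp [f, Real.zero_rpow (by linarith : α ≠ 0)]

/-- The recursion for `evenAbs` and `oddPt` describes the orbit only while signs alternate, so signs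
and formulas are established together by strong induction. -/
lemma mem_RLRL_iff {α a : ℝ} (hα : 1 < α) :
    a ∈ RLRL α ↔ 0 < a ∧ Admissible α (a ^ (α - 1)) := by
  rw [mem_RLRL_iff_sign]
  constructor
  · intro h
    have ha : 0 < a := by
      have := (h 0).1
      simpa [f_zero hα] using this
    have key : ∀ j, 0 ≤ evenAbs α (a ^ (α - 1)) j ∧ 0 < oddPt α (a ^ (α - 1)) j ∧
        0 < evenAbs α (a ^ (α - 1)) (j + 1) := by
      have pos_of : ∀ j, (∀ i ≤ j, 0 ≤ evenAbs α (a ^ (α - 1)) i) →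
          (∀ i < j, 0 ≤ oddPt α (a ^ (α - 1)) i) →
          0 < oddPt α (a ^ (α - 1)) j ∧ 0 < evenAbs α (a ^ (α - 1)) (j + 1) := by
        intro j hE hO
        have h1 := (iterate_eq ha j hE hO).2
        have h2 := h j
        rw [h1] at h2
        have hO' : 0 < oddPt α (a ^ (α - 1)) j := pos_of_mul_pos_right h2.1 ha.le
        refine ⟨hO', ?_⟩
        have h3 := h2.2
        rw [show 2 * j + 2 = (2 * j + 1) + 1 by ring, Function.iterate_succ_apply', h1,
          f_mul ha hO'.le, neg_lt_zero] at h3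
        exact pos_of_mul_pos_right h3 ha.le
      intro j
      induction j using Nat.strong_induction_on with
      | _ j ih =>
        have hE : ∀ i ≤ j, 0 ≤ evenAbs α (a ^ (α - 1)) i := by
          intro i hi
          cases i with
          | zero => exact le_rfl
          | succ i => exact (ih i (by omega)).2.2.le
        exact ⟨hE j le_rfl, pos_of j hE fun i hi => (ih i hi).2.1.le⟩
    refine ⟨ha, ?_⟩
    have h1 := (key 0).2.2
    rw [zero_add, evenAbs_one hα] at h1
    exact
      { one_lt_exp := hα
        one_lt := by linarith
        e_zero := rfl
        o_eq := fun _ => rfl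
        e_succ := fun _ => rfl
        o_pos := fun j => (key j).2.1
        e_succ_pos := fun j => (key j).2.2 }
  · rintro ⟨ha, H⟩ j
    have h1 := (iterate_eq ha j (fun i _ => H.e_nonneg i) (fun i _ => (H.o_pos i).le)).2
    have h2 := (iterate_eq ha (j + 1) (fun i _ => H.e_nonneg i) (fun i _ => (H.o_pos i).le)).1
    rw [h1, show 2 * j + 2 = 2 * (j + 1) by ring, h2]
    exact ⟨mul_pos ha (H.o_pos j), neg_lt_zero.2 (mul_pos ha (H.e_succ_pos j))⟩

lemma pt_eq {α a : ℝ} (hα : 1 < α) (ha : a ∈ RLRL α) (j : ℕ) :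
    pt α a (2 * j) = -evenAbs α (a ^ (α - 1)) j ∧
      pt α a (2 * j + 1) = oddPt α (a ^ (α - 1)) j := by
  obtain ⟨ha, H⟩ := (mem_RLRL_iff hα).1 ha
  obtain ⟨h1, h2⟩ := iterate_eq ha j (fun i _ => H.e_nonneg i) (fun i _ => (H.o_pos i).le)
  unfold pt
  rw [h1, h2, f_zero hα]
  constructor <;> field_simp

/-! ### Derivatives with respect to t -/

/-- Logarithmic velocity of `oddPt`, when `t` moves with velocity `t * (2 - t) / 2`. -/
def lamOdd (α t : ℝ) : ℕ → ℝ
  | 0 => 0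
  | j + 1 => -(zeta α t (evenAbs α t (j + 1)) * (α * ((1 + evenAbs α t (j + 1)) *
      ((2 - t) / 2 + α * lamOdd α t j) / evenAbs α t (j + 1)) + (2 - t) / 2))

/-- Logarithmic velocity of `evenAbs` at positive indices. -/
def lamEvenSucc (α t : ℝ) (j : ℕ) : ℝ :=
  (1 + evenAbs α t (j + 1)) * ((2 - t) / 2 + α * lamOdd α t j) / evenAbs α t (j + 1)

/-- Logarithmic velocity of `evenAbs`, with a conventional value at `0`. -/
def lamEven (α t : ℝ) : ℕ → ℝ
  | 0 => lamEvenSucc α t 0 - evenAbs α t 1 * (lamEvenSucc α t 0 - lamEvenSucc α t 1) /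
      (evenAbs α t 1 - evenAbs α t 2)
  | j + 1 => lamEvenSucc α t j

lemma Admissible.logVelocity {α t : ℝ} (H : Admissible α t) :
    LogVelocity α t (evenAbs α t) (oddPt α t) (lamEven α t) (lamOdd α t) :=
  { toCriticalOrbit := H
    L_eq := fun j => by
      cases j with
      | zero =>
        simp [lamOdd, evenAbs, zeta, Real.zero_rpow (by linarith [H.one_lt_exp] : α ≠ 0)]
      | succ j => rfl
    l_succ := fun j => by
      have := H.e_succ_pos j
      simp only [lamEven, lamEvenSucc]
      field_simp
    l_zero := by
      simp [vel, crossVel, lamEven, evenAbs] }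

/-- Dividing by t(2-t)/2 turns velocities into t-derivatives. The conventional `lamEven α t 0` is
harmless, being multiplied by e_0 = 0. -/
lemma Admissible.hasDerivAt {α t : ℝ} (H : Admissible α t) (j : ℕ) :
    HasDerivAt (fun s => evenAbs α s j) (evenAbs α t j * lamEven α t j / (t * ((2 - t) / 2))) t ∧
      HasDerivAt (fun s => oddPt α s j) (oddPt α t j * lamOdd α t j / (t * ((2 - t) / 2))) t := by
  have hα := H.one_lt_exp
  have ht := H.one_lt
  have ht2 := H.lt_two
  have hV := H.logVelocity
  have hw : 2 - t ≠ 0 := by linarith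
  have key : ∀ j, HasDerivAt (fun s => evenAbs α s j)
      (evenAbs α t j * lamEven α t j / (t * ((2 - t) / 2))) t →
      HasDerivAt (fun s => oddPt α s j)
        (oddPt α t j * lamOdd α t j / (t * ((2 - t) / 2))) t := by
    intro j hE
    have h1 := ((hasDerivAt_id t).mul (hE.rpow_const (p := α) (Or.inr hα.le))).const_sub 1
    refine h1.congr_deriv ?_
    have ho := H.o_pos j
    rw [hV.L_eq, H.zeta_eq]
    simp only [id, one_mul]
    have hp : evenAbs α t j * evenAbs α t j ^ (α - 1) = evenAbs α t j ^ α := by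
      rcases (H.e_nonneg j).eq_or_lt with h | h
      · rw [← h, zero_mul, Real.zero_rpow (by linarith)]
      · rw [Real.rpow_sub_one h.ne']; field_simp
    have e1 : evenAbs α t j * lamEven α t j / (t * ((2 - t) / 2)) * α * evenAbs α t j ^ (α - 1) =
        (evenAbs α t j * evenAbs α t j ^ (α - 1)) * (lamEven α t j / (t * ((2 - t) / 2)) * α) := by
      ring
    rw [e1, hp]
    field_simp
    ring
  induction j with
  | zero =>
    have h0 : HasDerivAt (fun s => evenAbs α s 0)
        (evenAbs α t 0 * lamEven α t 0 / (t * ((2 - t) / 2))) t := by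
      have : evenAbs α t 0 = 0 := rfl
      rw [this, zero_mul, zero_div]
      exact hasDerivAt_const t 0
    exact ⟨h0, key 0 h0⟩
  | succ j ih =>
    have ho := H.o_pos j
    have h1 := ((hasDerivAt_id t).mul (ih.2.rpow_const (p := α) (Or.inr hα.le))).sub_const 1
    have h0 : HasDerivAt (fun s => evenAbs α s (j + 1))
        (evenAbs α t (j + 1) * lamEven α t (j + 1) / (t * ((2 - t) / 2))) t := by
      refine h1.congr_deriv ?_
      rw [hV.l_succ, H.e_succ]
      simp only [id, one_mul]
      rw [Real.rpow_sub_one ho.ne']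
      field_simp
      ring
    exact ⟨h0, key _ h0⟩

lemma hasDerivAt_log_div_sub {a₀ a₁ a₂ : ℝ → ℝ} {l₀ l₁ l₂ w t : ℝ}
    (h₀ : HasDerivAt a₀ (a₀ t * l₀ / w) t) (h₁ : HasDerivAt a₁ (a₁ t * l₁ / w) t)
    (h₂ : HasDerivAt a₂ (a₂ t * l₂ / w) t) (h02 : a₀ t ≠ a₂ t) (h12 : a₁ t ≠ a₂ t) :
    HasDerivAt (fun s => Real.log ((a₁ s - a₂ s) / (a₂ s - a₀ s)))
      (crossVel (a₀ t) (a₁ t) (a₂ t) l₀ l₁ l₂ / w) t := by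
  have n1 := sub_ne_zero.2 h12
  have n0 := sub_ne_zero.2 h02.symm
  refine (((h₁.sub h₂).div (h₂.sub h₀) n0).log (div_ne_zero n1 n0)).congr_deriv ?_
  simp only [Pi.sub_apply, Pi.div_apply]
  unfold crossVel
  field_simp
  ring

/-- This is why the speed of t is t(2-t)/2: the reference coordinate then has unit velocity. -/
lemma hasDerivAt_log_div_two_sub {t : ℝ} (h0 : 0 < t) (h2 : t < 2) :
    HasDerivAt (fun s : ℝ => Real.log (s / (2 - s))) (1 / (t * ((2 - t) / 2))) t := by
  have h := sub_pos.2 h2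
  refine (((hasDerivAt_id t).div ((hasDerivAt_id t).const_sub 2) h.ne').log
    (div_pos h0 h).ne').congr_deriv ?_
  simp only [id, Pi.div_apply]
  field_simp
  ring

/-- The Poincaré coordinates grow faster than `log (t / (2 - t))`. -/
lemma strictMonoOn_log_sub {α t₁ : ℝ} (hadm : ∀ t ∈ Set.Ioo 1 t₁, Admissible α t) (j : ℕ) :
    StrictMonoOn (fun s => Real.log ((evenAbs α s (j + 1) - evenAbs α s (j + 2)) /
        (evenAbs α s (j + 2) - evenAbs α s j)) - Real.log (s / (2 - s))) (Set.Ioo 1 t₁) ∧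
      StrictMonoOn (fun s => Real.log ((oddPt α s (j + 1) - oddPt α s (j + 2)) /
        (oddPt α s (j + 2) - oddPt α s j)) - Real.log (s / (2 - s))) (Set.Ioo 1 t₁) := by
  have hE : ∀ t ∈ Set.Ioo 1 t₁, HasDerivAt
      (fun s => Real.log ((evenAbs α s (j + 1) - evenAbs α s (j + 2)) /
        (evenAbs α s (j + 2) - evenAbs α s j)) - Real.log (s / (2 - s)))
      (vel (evenAbs α t) (lamEven α t) j / (t * ((2 - t) / 2)) - 1 / (t * ((2 - t) / 2))) t := by
    intro t ht
    have H := hadm t ht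
    exact (hasDerivAt_log_div_sub (H.hasDerivAt j).1 (H.hasDerivAt (j + 1)).1
      (H.hasDerivAt (j + 2)).1 (H.e_ne_add_two j) (H.e_ne_succ j)).sub
      (hasDerivAt_log_div_two_sub (by linarith [ht.1]) H.lt_two)
  have hO : ∀ t ∈ Set.Ioo 1 t₁, HasDerivAt
      (fun s => Real.log ((oddPt α s (j + 1) - oddPt α s (j + 2)) /
        (oddPt α s (j + 2) - oddPt α s j)) - Real.log (s / (2 - s)))
      (vel (oddPt α t) (lamOdd α t) j / (t * ((2 - t) / 2)) - 1 / (t * ((2 - t) / 2))) t := by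
    intro t ht
    have H := hadm t ht
    exact (hasDerivAt_log_div_sub (H.hasDerivAt j).2 (H.hasDerivAt (j + 1)).2
      (H.hasDerivAt (j + 2)).2 (H.o_ne (H.e_ne_add_two j)) (H.o_ne (H.e_ne_succ j))).sub
      (hasDerivAt_log_div_two_sub (by linarith [ht.1]) H.lt_two)
  have hpos : ∀ t ∈ Set.Ioo 1 t₁, ∀ v, 1 < v →
      0 < v / (t * ((2 - t) / 2)) - 1 / (t * ((2 - t) / 2)) := by
    intro t ht v hv
    have H := hadm t ht
    rw [← sub_div]
    exact div_pos (by linarith) (mul_pos (by linarith [ht.1]) (by linarith [H.lt_two]))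
  constructor
  · refine strictMonoOn_of_deriv_pos (convex_Ioo 1 t₁)
      (fun t ht => (hE t ht).continuousAt.continuousWithinAt) fun t ht => ?_
    rw [interior_Ioo] at ht
    have V := (hadm t ht).logVelocity
    rw [(hE t ht).deriv]
    exact hpos t ht _ (V.one_lt_vel V.vel_zero_gt j).1
  · refine strictMonoOn_of_deriv_pos (convex_Ioo 1 t₁)
      (fun t ht => (hO t ht).continuousAt.continuousWithinAt) fun t ht => ?_
    rw [interior_Ioo] at ht
    have V := (hadm t ht).logVelocity
    rw [(hO t ht).deriv]
    exact hpos t ht _ (V.one_lt_vel V.vel_zero_gt j).2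

/-! ### Back to Poincaré coordinates, ratios and the parameter ā -/

lemma abs_div_abs_eq {p q x : ℝ} (h : 0 < (x - p) / (q - x)) :
    |x - p| / |p - q| = (x - p) / (q - x) / (1 + (x - p) / (q - x)) := by
  have hq : q - x ≠ 0 := by
    intro h0
    rw [h0, div_zero] at h
    exact lt_irrefl _ h
  have e1 : (x - p) / (q - x) / (1 + (x - p) / (q - x)) = (x - p) / (q - p) := by
    rw [one_add_div hq, div_div_div_cancel_right₀ hq]
    congr 1; ring
  rw [e1, abs_sub_comm p q, ← abs_div, abs_of_pos]
  rw [← e1]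
  positivity

lemma abs_div_abs_lt_of_poincare_lt {p q x p' q' x' : ℝ} (h : 0 < (x - p) / (q - x))
    (h' : 0 < (x' - p') / (q' - x')) (hlt : poincare p q x < poincare p' q' x') :
    |x - p| / |p - q| < |x' - p'| / |p' - q'| := by
  rw [abs_div_abs_eq h, abs_div_abs_eq h']
  have hX := (Real.log_lt_log_iff h h').1 hlt
  set X := (x - p) / (q - x)
  set X' := (x' - p') / (q' - x')
  rw [div_lt_div_iff₀ (by linarith) (by linarith)]
  linarith

lemma div_sub_pos {α t : ℝ} (H : Admissible α t) (j : ℕ) :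
    0 < (evenAbs α t (j + 1) - evenAbs α t (j + 2)) / (evenAbs α t (j + 2) - evenAbs α t j) ∧
    0 < (oddPt α t (j + 1) - oddPt α t (j + 2)) / (oddPt α t (j + 2) - oddPt α t j) := by
  rcases Nat.even_or_odd j with h | ⟨m, rfl⟩
  · obtain ⟨h1, h2⟩ := H.lt_of_even h
    have h3 := H.o_lt h1
    have h4 := H.o_lt h2
    exact ⟨div_pos (by linarith) (by linarith),
      div_pos_of_neg_of_neg (by linarith) (by linarith)⟩
  · obtain ⟨h1, h2⟩ := H.lt_of_even' (even_two_mul m)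
    have h3 := H.o_lt h1
    have h4 := H.o_lt h2
    exact ⟨div_pos_of_neg_of_neg (by linarith) (by linarith),
      div_pos (by linarith) (by linarith)⟩

/-- The cross ratios of the rescaled orbit in terms of `evenAbs` and `oddPt`. -/
lemma pt_cross_eq {α a : ℝ} (hα : 1 < α) (ha : a ∈ RLRL α) (j : ℕ) :
    (pt α a (2 * j + 4) - pt α a (2 * j + 2)) / (pt α a (2 * j) - pt α a (2 * j + 4)) =
      (evenAbs α (a ^ (α - 1)) (j + 1) - evenAbs α (a ^ (α - 1)) (j + 2)) /
        (evenAbs α (a ^ (α - 1)) (j + 2) - evenAbs α (a ^ (α - 1)) j) ∧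
    (pt α a (2 * j + 1 + 4) - pt α a (2 * j + 1 + 2)) /
        (pt α a (2 * j + 1) - pt α a (2 * j + 1 + 4)) =
      (oddPt α (a ^ (α - 1)) (j + 1) - oddPt α (a ^ (α - 1)) (j + 2)) /
        (oddPt α (a ^ (α - 1)) (j + 2) - oddPt α (a ^ (α - 1)) j) := by
  obtain ⟨e0, o0⟩ := pt_eq hα ha j
  obtain ⟨e1, o1⟩ := pt_eq hα ha (j + 1)
  obtain ⟨e2, o2⟩ := pt_eq hα ha (j + 2)
  rw [show 2 * j + 4 = 2 * (j + 2) by ring, show 2 * j + 2 = 2 * (j + 1) by ring,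
    show 2 * j + 1 + 4 = 2 * (j + 2) + 1 by ring, show 2 * j + 1 + 2 = 2 * (j + 1) + 1 by ring,
    e0, e1, e2, o0, o1, o2]
  constructor
  · congr 1 <;> ring
  · rw [← neg_sub (oddPt α (a ^ (α - 1)) (j + 1)), ← neg_sub (oddPt α (a ^ (α - 1)) (j + 2))
      (oddPt α (a ^ (α - 1)) j), neg_div_neg_eq]

lemma pt_two {α a : ℝ} (hα : 1 < α) (ha : a ∈ RLRL α) : pt α a 2 = 1 - a ^ (α - 1) := by
  have := (pt_eq hα ha 1).1
  rw [evenAbs_one hα] at this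
  rw [show 2 = 2 * 1 by norm_num, this]; ring

lemma poincare_one_neg_one {α a : ℝ} (hα : 1 < α) (ha : a ∈ RLRL α) :
    poincare 1 (-1) (pt α a 2) = Real.log (a ^ (α - 1) / (2 - a ^ (α - 1))) := by
  rw [pt_two hα ha, poincare]
  congr 1
  rw [← neg_div_neg_eq]
  congr 1 <;> ring

lemma abar_eq {α a : ℝ} (hα : 1 < α) (ha : a ∈ RLRL α) :
    abar α a = Real.log ((a ^ (α - 1) - 1) / (1 - (a ^ (α - 1) - 1))) := by
  have H := ((mem_RLRL_iff hα).1 ha).2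
  have ht := H.one_lt
  rw [abar, pt_two hα ha, abs_of_neg (by linarith), poincare]
  congr 2 <;> ring

lemma strictMonoOn_log_div_one_sub :
    StrictMonoOn (fun b : ℝ => Real.log (b / (1 - b))) (Set.Ioo 0 1) := by
  intro b hb c hc hbc
  have h1 := sub_pos.2 hb.2
  have h2 := sub_pos.2 hc.2
  refine Real.log_lt_log (div_pos hb.1 h1) ?_
  rw [div_lt_div_iff₀ h1 h2]
  nlinarith

theorem strictMonoOn_abar {α : ℝ} (hα : 1 < α) : StrictMonoOn (abar α) (RLRL α) := by
  intro a ha a' ha' h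
  obtain ⟨hpos, H⟩ := (mem_RLRL_iff hα).1 ha
  obtain ⟨-, H'⟩ := (mem_RLRL_iff hα).1 ha'
  have ht := Real.rpow_lt_rpow hpos.le h (by linarith : 0 < α - 1)
  rw [abar_eq hα ha, abar_eq hα ha']
  exact strictMonoOn_log_div_one_sub ⟨by linarith [H.one_lt], by linarith [H.lt_two]⟩
    ⟨by linarith [H'.one_lt], by linarith [H'.lt_two]⟩ (by linarith)

theorem image_abar {α t₁ : ℝ} (hα : 1 < α) (h1 : 1 < t₁) (h2 : t₁ < 2)
    (hadm : ∀ t, Admissible α t ↔ t ∈ Set.Ioo 1 t₁) :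
    abar α '' RLRL α = Set.Iio (Real.log ((t₁ - 1) / (1 - (t₁ - 1)))) := by
  ext z
  constructor
  · rintro ⟨a, ha, rfl⟩
    obtain ⟨-, H⟩ := (mem_RLRL_iff hα).1 ha
    have ht := (hadm _).1 H
    rw [abar_eq hα ha]
    exact strictMonoOn_log_div_one_sub ⟨by linarith [ht.1], by linarith [ht.2]⟩
      ⟨by linarith, by linarith⟩ (by linarith [ht.2])
  · intro hz
    have hz : z < Real.log ((t₁ - 1) / (1 - (t₁ - 1))) := hz
    -- The logistic inverse of z; b plays the role of t - 1, so the parameter is a = (1 +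
    -- b)^(1/(α-1)).
    set b := Real.exp z / (1 + Real.exp z) with hb
    have he := Real.exp_pos z
    have hb0 : 0 < b := by positivity
    have hb1 : b < 1 := by rw [hb, div_lt_one (by positivity)]; linarith
    have hbz : Real.log (b / (1 - b)) = z := by
      have : b / (1 - b) = Real.exp z := by
        have : 1 - b = 1 / (1 + Real.exp z) := by rw [hb]; field_simp; ring
        rw [this, hb]; field_simp
      rw [this, Real.log_exp]
    have hbt : b < t₁ - 1 := by
      rw [← hbz] at hz
      exact (strictMonoOn_log_div_one_sub.lt_iff_lt ⟨hb0, hb1⟩ ⟨by linarith, by linarith⟩).1 hz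
    have hpow : ((1 + b) ^ (1 / (α - 1))) ^ (α - 1) = 1 + b := by
      rw [← Real.rpow_mul (by linarith), one_div_mul_cancel (by linarith), Real.rpow_one]
    have hmem : (1 + b) ^ (1 / (α - 1)) ∈ RLRL α := by
      rw [mem_RLRL_iff hα, hpow, hadm]
      exact ⟨by positivity, by linarith, by linarith⟩
    refine ⟨_, hmem, ?_⟩
    rw [abar_eq hα hmem, hpow, add_sub_cancel_left, hbz]

/-- The Poincaré coordinates grow faster than that of the second point. -/
theorem poincare_sub_gt {α a a' : ℝ} (hα : 1 < α) (ha : a ∈ RLRL α) (ha' : a' ∈ RLRL α)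
    (h : a < a') (n : ℕ) :
    poincare (pt α a' (n + 2)) (pt α a' n) (pt α a' (n + 4)) -
        poincare (pt α a (n + 2)) (pt α a n) (pt α a (n + 4)) >
      poincare 1 (-1) (pt α a' 2) - poincare 1 (-1) (pt α a 2) := by
  obtain ⟨t₁, -, -, hadm⟩ := exists_admissible_iff hα
  obtain ⟨hpos, H⟩ := (mem_RLRL_iff hα).1 ha
  obtain ⟨-, H'⟩ := (mem_RLRL_iff hα).1 ha'
  have hmono := strictMonoOn_log_sub (fun t ht => (hadm t).2 ht)
  have ht := Real.rpow_lt_rpow hpos.le h (by linarith : 0 < α - 1)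
  rw [poincare_one_neg_one hα ha, poincare_one_neg_one hα ha']
  unfold poincare
  rcases Nat.even_or_odd' n with ⟨j, rfl | rfl⟩
  · rw [(pt_cross_eq hα ha j).1, (pt_cross_eq hα ha' j).1]
    have := (hmono j).1 ((hadm _).1 H) ((hadm _).1 H') ht
    simp only at this
    linarith
  · rw [(pt_cross_eq hα ha j).2, (pt_cross_eq hα ha' j).2]
    have := (hmono j).2 ((hadm _).1 H) ((hadm _).1 H') ht
    simp only at this
    linarith

lemma poincare_one_neg_one_lt {α a a' : ℝ} (hα : 1 < α) (ha : a ∈ RLRL α) (ha' : a' ∈ RLRL α)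
    (h : a < a') : poincare 1 (-1) (pt α a 2) < poincare 1 (-1) (pt α a' 2) := by
  obtain ⟨hpos, H⟩ := (mem_RLRL_iff hα).1 ha
  obtain ⟨-, H'⟩ := (mem_RLRL_iff hα).1 ha'
  have ht := Real.rpow_lt_rpow hpos.le h (by linarith : 0 < α - 1)
  have h1 := H.one_lt
  have h2 := H'.lt_two
  rw [poincare_one_neg_one hα ha, poincare_one_neg_one hα ha']
  refine Real.log_lt_log (div_pos (by linarith) (by linarith)) ?_
  rw [div_lt_div_iff₀ (by linarith) (by linarith)]
  nlinarith

end PowerLaw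

end

theorem theorem5p1 (α : ℝ) (hα : 1 < α) :
    ∃ abar₁ : ℝ,
      StrictMonoOn (PowerLaw.abar α) (PowerLaw.RLRL α) ∧
      PowerLaw.abar α '' PowerLaw.RLRL α = Set.Iio abar₁ ∧
      ∀ a ∈ PowerLaw.RLRL α, ∀ a' ∈ PowerLaw.RLRL α,
        PowerLaw.abar α a < PowerLaw.abar α a' →
          (∀ n : ℕ, PowerLaw.ratioEven α n a < PowerLaw.ratioEven α n a') ∧
          (∀ n : ℕ, PowerLaw.ratioOdd α n a < PowerLaw.ratioOdd α n a') ∧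
          (∀ n : ℕ,
            PowerLaw.poincare (PowerLaw.pt α a' (n + 2)) (PowerLaw.pt α a' n)
                (PowerLaw.pt α a' (n + 4)) -
              PowerLaw.poincare (PowerLaw.pt α a (n + 2)) (PowerLaw.pt α a n)
                (PowerLaw.pt α a (n + 4)) >
            PowerLaw.poincare 1 (-1) (PowerLaw.pt α a' 2) -
              PowerLaw.poincare 1 (-1) (PowerLaw.pt α a 2)) := by
  obtain ⟨t₁, h1, h2, hadm⟩ := PowerLaw.exists_admissible_iff hα
  have hmono := PowerLaw.strictMonoOn_abar hα
  refine ⟨_, hmono, PowerLaw.image_abar hα h1 h2 hadm, ?_⟩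
  intro a ha a' ha' hlt
  have haa : a < a' := (hmono.lt_iff_lt ha ha').1 hlt
  have hgt := PowerLaw.poincare_sub_gt hα ha ha' haa
  have hs := PowerLaw.poincare_one_neg_one_lt hα ha ha' haa
  have H := ((PowerLaw.mem_RLRL_iff hα).1 ha).2
  have H' := ((PowerLaw.mem_RLRL_iff hα).1 ha').2
  refine ⟨fun n => ?_, fun n => ?_, hgt⟩
  · refine PowerLaw.abs_div_abs_lt_of_poincare_lt ?_ ?_ (by linarith [hgt (2 * n)])
    · rw [(PowerLaw.pt_cross_eq hα ha n).1]
      exact (PowerLaw.div_sub_pos H n).1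
    · rw [(PowerLaw.pt_cross_eq hα ha' n).1]
      exact (PowerLaw.div_sub_pos H' n).1
  · refine PowerLaw.abs_div_abs_lt_of_poincare_lt ?_ ?_ (by linarith [hgt (2 * n + 1)])
    · exact (PowerLaw.pt_cross_eq hα ha n).2 ▸ (PowerLaw.div_sub_pos H n).2
    · exact (PowerLaw.pt_cross_eq hα ha' n).2 ▸ (PowerLaw.div_sub_pos H' n).2
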